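/- **Lemma (Amenable Reduction Lemma).** Let $X$ and $Z$ be topological spaces, where $Z$ has a contractible universal cover (that is, there is a surjective covering map $E\to Z$ with $E$ contractible), and let $\alpha : X\to Z$ be continuous. Let $\Sigma$ be a simplicial set (for instance the one given by a simplicial complex with ordered vertices, or by a $\Delta$-complex), let $c_\Sigma=\sum_i r_i\sigma_i$ be an $n$-dimensional simplicial cycle on $\Sigma$ with coefficients $r_i\in\mathbb R$ and pairwise distinct $n$-simplices $\sigma_i$ of $\Sigma$, let $f:|\Sigma|\to X$ be a continuous map on the geometric realization, and let $c=f_*c_\Sigma$ be the resulting singular cycle in $X$, with homology class $[c]\in H_n(X;\mathbb R)$. Every singular cycle of $X$ arises in this way, e.g. with $\Sigma$ the singular simplicial set of $X$. Let $(V_\ell)_\ell$ be a partial coloring of $c$, that is, a family of pairwise disjoint sets of vertices of $\Sigma$. A simplex $\sigma$ of $\Sigma$ is called *essential* if neither of the following holds: - $\sigma$ has two distinct vertices (as vertices of $\Sigma$) in the same $V_\ell$; - $\sigma$ has two vertices that are the same vertex of $\Sigma$, and the $f$-image of the edge of $\sigma$ between them is a null-homotopic loop in $X$. Suppose that $\alpha\circ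 f$ sends all vertices of the simplices $\sigma_i$ with $r_i\ne 0$ to one point $z_0\in Z$. For each $\ell$ let $\Gamma_\ell\le\pi_1(Z,z_0)$ be the subgroup generated by the classes of the loops $\alpha\circ f\circ e$, where $e$ runs over the edges, with both endpoints in $V_\ell$, of the simplices $\sigma_i$ with $r_i\neq 0$. Suppose that $\Gamma_\ell$ is an amenable (discrete) group for every $\ell$. Then $$\|\alpha_*[c]\|_\Delta\;\le\;\sum_{\sigma_i\ \text{essential}}|r_i| .$$ Here, for a class $h\in H_n(Z;\mathbb R)$, the simplicial norm $\|h\|_\Delta$ is the infimum of $\sum_j|s_j|$ over all real singular cycles $\sum_j s_j\tau_j$ (distinct singular simplices $\tau_j$) that represent $h$. -/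

import Mathlib

open CategoryTheory
open scoped Simplicial

universe u v

noncomputable section

namespace AmenableReduction

/-! ### Real chains, cycles, homology classes and the simplicial norm -/

/-- The coefficients `ℝ`, as an object of the category of real vector spaces in universe `u`. -/
abbrev realCoeff : ModuleCat.{u} ℝ := ModuleCat.of ℝ (ULift.{u} ℝ)

/-- The element `∑ r_i σ_i` of the real chain complex of a simplicial set `S` that has the finitely
many simplices `σ_i` and coefficients `r_i` recorded by the finitely supported function `c`. -/
def toChain (S : SSet.{u}) {n : ℕ} (c : S _⦋n⦌ →₀ ℝ) : (S.chainComplex realCoeff.{u}).X n :=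
  c.sum fun σ r => (S.ιChainComplex (R := realCoeff.{u}) σ).hom (ULift.up r)

/-- The chain `c` is a cycle: its boundary vanishes. -/
def IsCycle (S : SSet.{u}) {n : ℕ} (c : S _⦋n⦌ →₀ ℝ) : Prop :=
  ∀ m : ℕ, ((S.chainComplex realCoeff.{u}).d n m).hom (toChain S c) = 0

/-- Real simplicial homology of a simplicial set. -/
abbrev simplicialHomology (n : ℕ) (S : SSet.{u}) : ModuleCat.{u} ℝ := S.homology realCoeff.{u} n

/-- The chain `c` is a cycle and represents the real homology class `h`. -/
def Represents (S : SSet.{u}) {n : ℕ} (c : S _⦋n⦌ →₀ ℝ)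
    (h : simplicialHomology n S) : Prop :=
  ∃ z : (S.chainComplex realCoeff.{u}).cycles n,
    ((S.chainComplex realCoeff.{u}).iCycles n).hom z = toChain S c ∧
      ((S.chainComplex realCoeff.{u}).homologyπ n).hom z = h

/-- The `ℓ¹`-norm of a chain: the sum of the absolute values of its coefficients. -/
def chainNorm {S : SSet.{u}} {n : ℕ} (c : S _⦋n⦌ →₀ ℝ) : ℝ := ∑ σ ∈ c.support, |c σ|

/-- Real singular homology of a topological space. -/
abbrev singularHomology (n : ℕ) (X : TopCat.{u}) : ModuleCat.{u} ℝ :=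
  ((AlgebraicTopology.singularHomologyFunctor (ModuleCat.{u} ℝ) n).obj realCoeff.{u}).obj X

/-- The map induced by a continuous map on real singular homology. -/
abbrev singularHomologyMap (n : ℕ) {X Y : TopCat.{u}} (α : X ⟶ Y) :
    singularHomology n X ⟶ singularHomology n Y :=
  ((AlgebraicTopology.singularHomologyFunctor (ModuleCat.{u} ℝ) n).obj realCoeff.{u}).map α

/-- The simplicial (semi-)norm of a real singular homology class: the infimum of the `ℓ¹`-norms
of the singular cycles representing it. -/
def simplicialNorm {X : TopCat.{u}} {n : ℕ} (h : singularHomology n X) : ℝ :=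
  sInf {r | ∃ c : (TopCat.toSSet.obj X) _⦋n⦌ →₀ ℝ,
    Represents (TopCat.toSSet.obj X) c h ∧ r = chainNorm c}

/-! ### Simplices: vertices and edges -/

/-- The `i`-th vertex of an `n`-simplex of a simplicial set. -/
def vertex {S : SSet.{u}} {n : ℕ} (σ : S _⦋n⦌) (i : Fin (n + 1)) : S _⦋0⦌ :=
  S.map (SimplexCategory.const ⦋0⦌ ⦋n⦌ i).op σ

/-- The straight path in the standard simplex from the `i`-th vertex to the `j`-th vertex. -/
def stdEdge {n : ℕ} (i j : Fin (n + 1)) :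
    Path (stdSimplex.vertex i : stdSimplex ℝ (Fin (n + 1))) (stdSimplex.vertex j) where
  toFun t := ⟨AffineMap.lineMap (Pi.single i 1 : Fin (n + 1) → ℝ) (Pi.single j 1) (t : ℝ),
    (convex_stdSimplex ℝ (Fin (n + 1))).lineMap_mem (single_mem_stdSimplex ℝ i)
      (single_mem_stdSimplex ℝ j) t.2⟩
  continuous_toFun := by
    refine Continuous.subtype_mk ?_ _
    exact AffineMap.lineMap_continuous.comp continuous_subtype_val
  source' := by ext; simp
  target' := by ext; simp

/-- The singular simplex `f ∘ σ` of `X`, for a simplex `σ` of a simplicial set `S` and a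
continuous map `f : |S| → X` on the geometric realization. -/
def singularSimplex {S : SSet.{u}} {X : TopCat.{u}} (f : SSet.toTop.obj S ⟶ X) {n : ℕ}
    (σ : S _⦋n⦌) : C(stdSimplex ℝ (Fin (n + 1)), X) :=
  TopCat.toSSetObjEquiv X _ ((sSetTopAdj.homEquiv S X f).app _ σ)

/-- The image in `X` of the `i`-th vertex of `σ`. -/
def vertexPoint {S : SSet.{u}} {X : TopCat.{u}} (f : SSet.toTop.obj S ⟶ X) {n : ℕ}
    (σ : S _⦋n⦌) (i : Fin (n + 1)) : X :=
  singularSimplex f σ (stdSimplex.vertex i)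

/-- The image in `X` of the edge of `σ` from the `i`-th to the `j`-th vertex. -/
def edgePath {S : SSet.{u}} {X : TopCat.{u}} (f : SSet.toTop.obj S ⟶ X) {n : ℕ}
    (σ : S _⦋n⦌) (i j : Fin (n + 1)) : Path (vertexPoint f σ i) (vertexPoint f σ j) :=
  (stdEdge i j).map (singularSimplex f σ).continuous

/-- A path is a null-homotopic loop: its endpoints agree, and it is homotopic relative to its
endpoints to a constant path. -/
def IsNullHomotopicLoop {X : Type u} [TopologicalSpace X] {x y : X} (p : Path x y) : Prop :=
  ∃ h : x = y, Path.Homotopic (p.cast rfl h) (Path.refl x)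

/-! ### Triples `(S, c, f)` with a partial coloring -/

/-- The singular chain `f_* c` of `X`, where `c` is a simplicial chain on `S` and `f : |S| → X`. -/
def pushChain {S : SSet.{u}} {X : TopCat.{u}} (f : SSet.toTop.obj S ⟶ X) {n : ℕ}
    (c : S _⦋n⦌ →₀ ℝ) : (TopCat.toSSet.obj X) _⦋n⦌ →₀ ℝ :=
  c.mapDomain fun σ => (sSetTopAdj.homEquiv S X f).app _ σ

/-- A simplex `σ` is essential, for the partial coloring given by the vertex sets `V ℓ`, unless it
has two distinct vertices of the same color, or two of its vertices are the same vertex of `S` and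
the edge between them is a null-homotopic loop in `X`. -/
def IsEssential {S : SSet.{u}} {X : TopCat.{u}} (f : SSet.toTop.obj S ⟶ X) {ι : Type v}
    (V : ι → Set (S _⦋0⦌)) {n : ℕ} (σ : S _⦋n⦌) : Prop :=
  ¬ (∃ (ℓ : ι) (i j : Fin (n + 1)),
      vertex σ i ≠ vertex σ j ∧ vertex σ i ∈ V ℓ ∧ vertex σ j ∈ V ℓ) ∧
  ¬ (∃ i j : Fin (n + 1),
      i ≠ j ∧ vertex σ i = vertex σ j ∧ IsNullHomotopicLoop (edgePath f σ i j))

/-- The sum of the absolute values of the coefficients of the essential simplices of `c`. -/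
def essentialNorm {S : SSet.{u}} {X : TopCat.{u}} (f : SSet.toTop.obj S ⟶ X) {ι : Type v}
    (V : ι → Set (S _⦋0⦌)) {n : ℕ} (c : S _⦋n⦌ →₀ ℝ) : ℝ :=
  open scoped Classical in
  ∑ σ ∈ c.support with IsEssential f V σ, |c σ|

/-- The subgroup of `π₁(Z, z₀)` generated by the `α`-images of the edges of the simplices of `c`
with both endpoints in the vertex set `W`. (Used when `α ∘ f` sends all vertices of `c` to `z₀`, so
that the endpoint equalities below always hold.) -/
def edgeSubgroup {S : SSet.{u}} {X Z : TopCat.{u}} (f : SSet.toTop.obj S ⟶ X) (α : X ⟶ Z) (z₀ : Z)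
    {n : ℕ} (c : S _⦋n⦌ →₀ ℝ) (W : Set (S _⦋0⦌)) : Subgroup (FundamentalGroup Z z₀) :=
  Subgroup.closure {g | ∃ σ ∈ c.support, ∃ i j : Fin (n + 1), vertex σ i ∈ W ∧ vertex σ j ∈ W ∧
    ∃ (hi : z₀ = α (vertexPoint f σ i)) (hj : z₀ = α (vertexPoint f σ j)),
      g = FundamentalGroup.fromPath
        (Path.Homotopic.Quotient.mk (((edgePath f σ i j).map α.hom.continuous).cast hi hj))}

/-! ### Amenable groups and aspherical spaces -/

/-- The space of bounded real functions on `G`. -/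
def boundedFunctions (G : Type u) : Submodule ℝ (G → ℝ) where
  carrier := {φ | ∃ C : ℝ, ∀ x, |φ x| ≤ C}
  zero_mem' := ⟨0, by simp⟩
  add_mem' := by
    rintro a b ⟨A, hA⟩ ⟨B, hB⟩
    exact ⟨A + B, fun x => (abs_add_le (a x) (b x)).trans (add_le_add (hA x) (hB x))⟩
  smul_mem' := by
    rintro r a ⟨A, hA⟩
    refine ⟨|r| * A, fun x => ?_⟩
    simpa [abs_mul] using mul_le_mul_of_nonneg_left (hA x) (abs_nonneg r)

/-- A (discrete) group is amenable if it has a left-invariant mean: a positive, normalized linear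
functional on the bounded functions that is invariant under left translations. -/
def IsAmenable (G : Type u) [Group G] : Prop :=
  ∃ m : boundedFunctions G →ₗ[ℝ] ℝ,
    (∀ φ : boundedFunctions G, (∀ x, 0 ≤ φ.1 x) → 0 ≤ m φ) ∧
    (∀ φ : boundedFunctions G, (∀ x, φ.1 x = 1) → m φ = 1) ∧
    (∀ (g : G) (φ ψ : boundedFunctions G), (∀ x, ψ.1 x = φ.1 (g * x)) → m ψ = m φ)

/-- `Z` has a contractible universal cover: there is a surjective covering map `E → Z` from a
contractible space `E` (which is then a universal cover of `Z`). -/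
def HasContractibleUniversalCover (Z : Type u) [TopologicalSpace Z] : Prop :=
  ∃ (E : Type u) (_ : TopologicalSpace E) (p : E → Z),
    ContractibleSpace E ∧ IsCoveringMap p ∧ Function.Surjective p

end AmenableReduction

end

/-!
The estimate is proved on the level of chains, by *diffusing* the vertices of the cycle in the
universal cover.

Let `p : E → Z` be the covering with `E` contractible. Every map from a contractible space to `Z`
lifts to `E` (`exists_lift_of_contractible`, from homotopy lifting, so that no local hypothesis on
`Z` is needed); in particular deck transformations exist and act simply transitively on the fibres.
Contractions of `E` to all its points can be chosen compatibly with them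
(`exists_equivariant_contraction`). Iterated cones formed with these contractions provide a straight
simplex for every tuple of points of `E`, compatible with faces and with deck transformations.

The loops at `z₀` act on the fibre over `z₀` by monodromy, and this commutes with deck
transformations. Reiter's condition (`IsAmenable.exists_almost_invariant`) gives each color `ℓ` a
finitely supported probability measure on `Γ_ℓ` which is almost invariant under the finitely many
edge classes that occur. A simplex of the cycle is lifted to `E`; each of its vertices is moved,
independently of the others, by a random element distributed according to the measure of its color;
the straight simplex on the new vertices is antisymmetrized (`smear`); and the result is projected
to `Z`. This does not depend on the lift, does not increase the norm, and is a chain map, because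
antisymmetrization commutes with the boundary and deleting a vertex integrates out a probability
measure (`boundary_altLift`). It is chain homotopic to the identity by an equivariant homotopy,
constructed degree by degree with cones (`smearHomotopy`). Hence the smeared chain represents
`α_* [c]` (`simplicialNorm_le_smear`).

It remains to see that an inessential simplex contributes almost nothing. The smeared simplex is an
alternating function of the laws of its vertices, so its norm is at most the distance of any two of
these laws (`l1_smear_le`). If two vertices have the same color, their lifts differ by an element of
`Γ_ℓ` and their laws almost agree; if two vertices coincide and the edge between them is
null-homotopic, then their lifts, and hence their laws, are equal.
-/

noncomputable section

namespace AmenableReduction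

/-! ### `ℓ¹`-norms and alternating boundaries -/

/-- The `ℓ¹`-norm of a finitely supported function. -/
def l1 {A : Type*} (c : A →₀ ℝ) : ℝ := c.sum fun _ r => |r|

section l1

variable {A B : Type*}

lemma l1_eq_sum_of_subset {c : A →₀ ℝ} {s : Finset A} (h : c.support ⊆ s) :
    l1 c = ∑ a ∈ s, |c a| :=
  Finsupp.sum_of_support_subset _ h _ (by simp)

lemma l1_nonneg (c : A →₀ ℝ) : 0 ≤ l1 c := Finset.sum_nonneg fun _ _ => abs_nonneg _

@[simp] lemma l1_zero : l1 (0 : A →₀ ℝ) = 0 := by simp [l1]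

@[simp] lemma l1_single (a : A) (r : ℝ) : l1 (Finsupp.single a r) = |r| := by
  simp [l1, Finsupp.sum_single_index]

lemma l1_add_le (c d : A →₀ ℝ) : l1 (c + d) ≤ l1 c + l1 d := by
  classical
  rw [l1_eq_sum_of_subset (Finsupp.support_add (g₁ := c) (g₂ := d)),
    l1_eq_sum_of_subset (s := c.support ∪ d.support) Finset.subset_union_left,
    l1_eq_sum_of_subset (s := c.support ∪ d.support) Finset.subset_union_right,
    ← Finset.sum_add_distrib]
  exact Finset.sum_le_sum fun a _ => abs_add_le _ _

lemma l1_smul (r : ℝ) (c : A →₀ ℝ) : l1 (r • c) = |r| * l1 c := by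
  rw [l1_eq_sum_of_subset (Finsupp.support_smul (b := r) (g := c)), l1, Finsupp.sum,
    Finset.mul_sum]
  simp [abs_mul]

lemma l1_sum_le {ι : Type*} (s : Finset ι) (f : ι → A →₀ ℝ) :
    l1 (∑ i ∈ s, f i) ≤ ∑ i ∈ s, l1 (f i) := by
  classical
  induction s using Finset.induction_on with
  | empty => simp
  | insert i s hi ih =>
    rw [Finset.sum_insert hi, Finset.sum_insert hi]
    exact (l1_add_le _ _).trans (by gcongr)

/-- Extending a map to free modules linearly multiplies the `ℓ¹`-norm by at most its supremum
on the basis. -/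
lemma l1_linearCombination_le (f : A → B →₀ ℝ) (c : A →₀ ℝ) :
    l1 (Finsupp.linearCombination ℝ f c) ≤ ∑ a ∈ c.support, |c a| * l1 (f a) := by
  rw [Finsupp.linearCombination_apply, Finsupp.sum]
  exact (l1_sum_le _ _).trans (Finset.sum_le_sum fun a _ => (l1_smul _ _).le)

lemma l1_mapDomain_le (f : A → B) (c : A →₀ ℝ) : l1 (c.mapDomain f) ≤ l1 c := by
  rw [Finsupp.mapDomain, Finsupp.sum]
  exact (l1_sum_le _ _).trans (by simp only [l1_single]; rfl)

end l1

/-- The alternating sum `∑ (-1)^i d_i` of the maps induced by face maps `d_i`. -/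
def boundary {A B : Type*} {k : ℕ} (d : Fin k → A → B) : (A →₀ ℝ) →ₗ[ℝ] (B →₀ ℝ) :=
  ∑ i : Fin k, (-1 : ℝ) ^ (i : ℕ) • Finsupp.lmapDomain ℝ ℝ (d i)

lemma boundary_single {A B : Type*} {k : ℕ} (d : Fin k → A → B) (a : A) (r : ℝ) :
    boundary d (Finsupp.single a r) =
      ∑ i : Fin k, (-1 : ℝ) ^ (i : ℕ) • Finsupp.single (d i a) r := by
  simp only [boundary, LinearMap.sum_apply, LinearMap.smul_apply, Finsupp.lmapDomain_apply,
    Finsupp.mapDomain_single]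

/-- A map that commutes with the face maps commutes with the boundary. -/
lemma boundary_mapDomain {A B A' B' : Type*} {k : ℕ} (d : Fin k → A → B) (d' : Fin k → A' → B')
    (f : A → A') (g : B → B') (h : ∀ i a, d' i (f a) = g (d i a)) (c : A →₀ ℝ) :
    boundary d' (c.mapDomain f) = (boundary d c).mapDomain g := by
  induction c using Finsupp.induction_linear with
  | zero => simp
  | add c₁ c₂ h₁ h₂ => simp [Finsupp.mapDomain_add, h₁, h₂]
  | single a r =>
    rw [Finsupp.mapDomain_single, boundary_single, boundary_single, Finsupp.mapDomain_finsetSum]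
    simp only [h, Finsupp.mapDomain_smul, Finsupp.mapDomain_single]

/-- The boundary squares to zero, as soon as the face maps satisfy the simplicial identities. -/
lemma boundary_boundary {A B C : Type*} {k : ℕ} (d : Fin (k + 1) → A → B) (d' : Fin k → B → C)
    (h : ∀ i j a, d' (j.predAbove i) (d (i.succAbove j) a) = d' j (d i a)) (c : A →₀ ℝ) :
    boundary d' (boundary d c) = 0 := by
  induction c using Finsupp.induction_linear with
  | zero => simp
  | add c₁ c₂ h₁ h₂ => simp [h₁, h₂]
  | single a r =>
    simp only [boundary_single, map_sum, map_smul, Finset.smul_sum, smul_smul, ← pow_add]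
    rw [← Fintype.sum_prod_type']
    refine Finset.sum_involution (fun p _ => (p.1.succAbove p.2, p.2.predAbove p.1)) ?_ ?_ ?_ ?_
    · rintro ⟨i, j⟩ -
      rw [h, Fin.neg_one_pow_succAbove_add_predAbove, neg_smul, add_neg_cancel]
    · rintro ⟨i, j⟩ - - h'
      exact Fin.succAbove_ne i j congr($h'.1)
    · simp
    · rintro ⟨i, j⟩ -
      simp [Fin.succAbove_succAbove_predAbove, Fin.predAbove_predAbove_succAbove]

/-! ### Comparison with the chain complex of a simplicial set -/

section Bridge

open Limits

variable (S : SSet.{u})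

/-- The chain `∑ r_i σ_i`, as a linear function of the coefficients. -/
def toChainHom (n : ℕ) : (S _⦋n⦌ →₀ ℝ) →ₗ[ℝ] (S.chainComplex realCoeff.{u}).X n :=
  Finsupp.lsum ℝ fun σ =>
    (S.ιChainComplex (R := realCoeff.{u}) σ).hom ∘ₗ ULift.moduleEquiv.symm.toLinearMap

lemma toChainHom_apply {n : ℕ} (c : S _⦋n⦌ →₀ ℝ) : toChainHom S n c = toChain S c := rfl

lemma toChainHom_single {n : ℕ} (σ : S _⦋n⦌) (r : ℝ) :
    toChainHom S n (Finsupp.single σ r) =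
      (S.ιChainComplex (R := realCoeff.{u}) σ).hom (ULift.up r) := by
  rw [toChainHom, Finsupp.lsum_single]
  rfl

/-- The boundary of simplicial chains of `S`. -/
abbrev simplicialBoundary (n : ℕ) : (S _⦋n + 1⦌ →₀ ℝ) →ₗ[ℝ] (S _⦋n⦌ →₀ ℝ) :=
  boundary fun i σ => S.δ i σ

lemma d_toChainHom {n : ℕ} (c : S _⦋n + 1⦌ →₀ ℝ) :
    ((S.chainComplex realCoeff.{u}).d (n + 1) n).hom (toChainHom S (n + 1) c) =
      toChainHom S n (simplicialBoundary S n c) := by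
  induction c using Finsupp.induction_linear with
  | zero => simp
  | add c₁ c₂ h₁ h₂ => simp [h₁, h₂]
  | single σ r =>
    rw [simplicialBoundary, boundary_single, toChainHom_single, map_sum]
    simp only [map_smul, toChainHom_single]
    have := congr(($(S.ιChainComplex_d (R := realCoeff.{u}) σ)).hom (ULift.up r))
    rw [ModuleCat.hom_comp, LinearMap.comp_apply] at this
    rw [this, ModuleCat.hom_sum, LinearMap.sum_apply]
    refine Finset.sum_congr rfl fun i _ => ?_
    rcases Nat.even_or_odd (i : ℕ) with hi | hi
    · simp [hi.neg_one_pow]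
    · simp [hi.neg_one_pow]

/-- The coordinate projections of the coproduct recover the coefficients of a chain. -/
lemma toChainHom_injective (n : ℕ) : Function.Injective (toChainHom S n) := by
  classical
  intro c c' h
  ext τ
  let π : (S.chainComplex realCoeff.{u}).X n ⟶ realCoeff.{u} :=
    (S.isColimitChainComplexXCofan realCoeff.{u} n).desc
      (Cofan.mk _ fun σ => if σ = τ then 𝟙 _ else 0)
  have hπ (σ : S _⦋n⦌) : S.ιChainComplex σ ≫ π = if σ = τ then 𝟙 _ else 0 :=
    (S.isColimitChainComplexXCofan realCoeff.{u} n).fac _ ⟨σ⟩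
  have key (c : S _⦋n⦌ →₀ ℝ) : π.hom (toChainHom S n c) = ULift.up (c τ) := by
    induction c using Finsupp.induction_linear with
    | zero => simp; rfl
    | add c₁ c₂ h₁ h₂ => rw [map_add, map_add, h₁, h₂]; rfl
    | single σ r =>
      have := congr(($(hπ σ)).hom (ULift.up r))
      rw [ModuleCat.hom_comp, LinearMap.comp_apply] at this
      rw [toChainHom_single, this]
      by_cases hσ : σ = τ
      · simp [hσ]
      · simp [hσ]; rfl
  simpa using (key c).symm.trans ((congrArg π.hom h).trans (key c'))

lemma boundary_eq_zero_of_isCycle {n : ℕ} {c : S _⦋n + 1⦌ →₀ ℝ} (hc : IsCycle S c) :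
    simplicialBoundary S n c = 0 :=
  toChainHom_injective S n <| by
    rw [map_zero, ← d_toChainHom, toChainHom_apply, hc n]

lemma chainComplexMap_toChainHom {S T : SSet.{u}} (φ : S ⟶ T) {n : ℕ} (c : S _⦋n⦌ →₀ ℝ) :
    ((SSet.chainComplexMap φ realCoeff.{u}).f n).hom (toChainHom S n c) =
      toChainHom T n (c.mapDomain (φ.app _)) := by
  induction c using Finsupp.induction_linear with
  | zero => simp
  | add c₁ c₂ h₁ h₂ => simp [h₁, h₂, Finsupp.mapDomain_add]
  | single σ r =>
    have := congr(($(SSet.ι_chainComplexMap_f _ _ φ realCoeff.{u} σ)).hom (ULift.up r))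
    rw [ModuleCat.hom_comp, LinearMap.comp_apply] at this
    rw [toChainHom_single, this, Finsupp.mapDomain_single, toChainHom_single]

/-- A representing cycle may be changed by a boundary. -/
lemma Represents.add_boundary {S : SSet.{u}} {n : ℕ} {c : S _⦋n⦌ →₀ ℝ}
    {h : simplicialHomology n S} (hc : Represents S c h) (b : S _⦋n + 1⦌ →₀ ℝ) :
    Represents S (c + simplicialBoundary S n b) h := by
  obtain ⟨z, hz, rfl⟩ := hc
  let K := S.chainComplex realCoeff.{u}
  refine ⟨z + (K.toCycles (n + 1) n).hom (toChainHom S (n + 1) b), ?_, ?_⟩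
  · rw [map_add, hz, ← toChainHom_apply, ← toChainHom_apply, map_add, ← d_toChainHom]
    congr 1
    exact congr(($(K.toCycles_i (n + 1) n)).hom _)
  · rw [map_add]
    have : (K.homologyπ n).hom ((K.toCycles (n + 1) n).hom (toChainHom S (n + 1) b)) = 0 :=
      congr(($(K.toCycles_comp_homologyπ (n + 1) n)).hom _)
    rw [this, add_zero]

/-- Representing cycles are natural with respect to continuous maps. -/
lemma Represents.map {X Z : TopCat.{u}} (α : X ⟶ Z) {n : ℕ} {c : (TopCat.toSSet.obj X) _⦋n⦌ →₀ ℝ}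
    {h : singularHomology n X} (hc : Represents (TopCat.toSSet.obj X) c h) :
    Represents (TopCat.toSSet.obj Z) (c.mapDomain ((TopCat.toSSet.map α).app _))
      ((singularHomologyMap n α).hom h) := by
  obtain ⟨z, hz, rfl⟩ := hc
  let φ := SSet.chainComplexMap (TopCat.toSSet.map α) realCoeff.{u}
  refine ⟨(HomologicalComplex.cyclesMap φ n).hom z, ?_, ?_⟩
  · rw [← toChainHom_apply, ← chainComplexMap_toChainHom, toChainHom_apply, ← hz]
    exact congr(($(HomologicalComplex.cyclesMap_i φ n)).hom z)
  · exact congr(($(HomologicalComplex.homologyπ_naturality φ n)).hom z).symm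

lemma simplicialNorm_le {X : TopCat.{u}} {n : ℕ} {h : singularHomology n X}
    {c : (TopCat.toSSet.obj X) _⦋n⦌ →₀ ℝ} (hc : Represents (TopCat.toSSet.obj X) c h) :
    simplicialNorm h ≤ l1 c :=
  csInf_le ⟨0, by rintro _ ⟨c, -, rfl⟩; exact l1_nonneg c⟩ ⟨c, hc, rfl⟩

end Bridge

/-! ### Reiter's condition for amenable groups -/

section Reiter

variable {G : Type u} [Group G]

open Finset in
/-- **Reiter's condition**. An amenable group carries finitely supported probability measures that
are almost invariant under any given finite family of left translations. -/
theorem IsAmenable.exists_almost_invariant (hG : IsAmenable G) {κ : Type*} [Fintype κ] (k : κ → G)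
    {ε : ℝ} (hε : 0 < ε) :
    ∃ μ : G →₀ ℝ, (∀ x, 0 ≤ μ x) ∧ μ.sum (fun _ r => r) = 1 ∧
      ∀ j, l1 (μ.mapDomain (k j * ·) - μ) < ε := by
  classical
  obtain ⟨m, hm0, hm1, hminv⟩ := hG
  let δ : G → lp (fun _ : G => ℝ) 1 := fun x => lp.single 1 x (1 : ℝ)
  let D : G → κ → lp (fun _ : G => ℝ) 1 := fun x j => δ (k j * x) - δ x
  have hδ (c : G →₀ ℝ) : ‖Finsupp.linearCombination ℝ δ c‖ = l1 c := by
    have h := lp.norm_sum_single (E := fun _ : G => ℝ) (p := 1) (by simp) c c.support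
    simp only [ENNReal.toReal_one, Real.rpow_one] at h
    rw [Finsupp.linearCombination_apply, Finsupp.sum]
    refine Eq.trans ?_ h
    simp [δ, ← lp.single_smul]
  let P : Set (G →₀ ℝ) := {μ | (∀ x, 0 ≤ μ x) ∧ Finsupp.linearCombination ℝ (fun _ => (1 : ℝ)) μ = 1}
  have hP : Convex ℝ P := by
    rintro μ ⟨hμ, hμ'⟩ ν ⟨hν, hν'⟩ a b ha hb hab
    refine ⟨fun x => ?_, by rw [map_add, map_smul, map_smul, hμ', hν']; simpa using hab⟩
    have := hμ x
    have := hν x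
    simp only [Finsupp.add_apply, Finsupp.smul_apply, smul_eq_mul]
    positivity
  -- The origin is a limit of averages of the differences `D x`: a functional that separates it
  -- from them would contradict the invariance of the mean.
  have h0 : (0 : κ → lp (fun _ : G => ℝ) 1) ∈ closure (Finsupp.linearCombination ℝ D '' P) := by
    by_contra h0
    obtain ⟨φ, s, hs, hφ⟩ := geometric_hahn_banach_point_closed
      (hP.linear_image (Finsupp.linearCombination ℝ D)).closure isClosed_closure h0
    rw [map_zero] at hs
    let ψ (j : κ) (x : G) : ℝ := φ (Pi.single j (δ x))
    have hψ (j : κ) : ψ j ∈ boundedFunctions G := by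
      refine ⟨‖φ‖, fun x => ?_⟩
      refine (φ.le_opNorm _).trans ?_
      have : ‖(Pi.single j (δ x) : κ → lp (fun _ : G => ℝ) 1)‖ = 1 := by
        rw [Pi.norm_single]
        simp [δ, lp.norm_single]
      rw [this, mul_one]
    have hψ' (j : κ) : (fun x => ψ j (k j * x)) ∈ boundedFunctions G := by
      obtain ⟨C, hC⟩ := hψ j
      exact ⟨C, fun x => hC _⟩
    have hD (x : G) : φ (D x) = ∑ j, (ψ j (k j * x) - ψ j x) := by
      conv_lhs => rw [← Finset.univ_sum_single (D x)]
      simp only [map_sum, D, Pi.single_sub, map_sub, ψ]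
    let F : boundedFunctions G := ∑ j, (⟨_, hψ' j⟩ - ⟨_, hψ j⟩)
    have hF (x : G) : s ≤ F.1 x := by
      have h1 : D x ∈ Finsupp.linearCombination ℝ D '' P := by
        refine ⟨Finsupp.single x 1, ⟨fun y => ?_, by simp⟩, by simp⟩
        rw [Finsupp.single_apply]
        split_ifs <;> norm_num
      have h2 := (hφ _ (subset_closure h1)).le
      rw [hD] at h2
      simpa [F] using h2
    have hmF : m F = 0 := by
      rw [map_sum]
      refine Finset.sum_eq_zero fun j _ => ?_
      rw [map_sub, hminv (k j) ⟨_, hψ j⟩ ⟨_, hψ' j⟩ fun _ => rfl, sub_self]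
    let one : boundedFunctions G := ⟨fun _ => 1, 1, by simp⟩
    have h1 := hm0 (F - s • one) fun x => by
      simpa [one] using hF x
    rw [map_sub, map_smul, hmF, hm1 one fun _ => rfl] at h1
    simp at h1
    linarith
  rw [Metric.mem_closure_iff] at h0
  obtain ⟨_, ⟨μ, ⟨hμ0, hμ1⟩, rfl⟩, hμ⟩ := h0 ε hε
  refine ⟨μ, hμ0, by simpa [Finsupp.linearCombination_apply] using hμ1, fun j => ?_⟩
  rw [dist_zero_left] at hμ
  refine lt_of_eq_of_lt ?_ ((norm_le_pi_norm _ j).trans_lt hμ)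
  rw [← hδ, map_sub, Finsupp.linearCombination_mapDomain]
  simp only [Finsupp.linearCombination_apply, Finsupp.sum, Finset.sum_apply, Pi.smul_apply, D,
    smul_sub, Finset.sum_sub_distrib, Function.comp_def]

end Reiter

/-! ### Antisymmetrized multilinear extensions -/

section Alternating

variable {E W : Type*} [AddCommGroup W] [Module ℝ W]

/-- The multilinear extension of a function on tuples to tuples of finitely supported
real functions (regarded as finite signed measures). -/
def multilinearLift (n : ℕ) :
    ((Fin n → E) → W) → MultilinearMap ℝ (fun _ : Fin n => E →₀ ℝ) W :=
  Nat.rec (fun t => MultilinearMap.constOfIsEmpty ℝ _ (t Fin.elim0))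
    (fun _ ih t => LinearMap.uncurryLeft
      (Finsupp.lift _ ℝ E fun e => ih fun y => t (Fin.cons e y))) n

lemma multilinearLift_succ (n : ℕ) (t : (Fin (n + 1) → E) → W) :
    multilinearLift (n + 1) t = LinearMap.uncurryLeft
      (Finsupp.lift _ ℝ E fun e => multilinearLift n fun y => t (Fin.cons e y)) := rfl

lemma multilinearLift_single (n : ℕ) (t : (Fin n → E) → W) (y : Fin n → E) :
    multilinearLift n t (fun i => Finsupp.single (y i) 1) = t y := by
  induction n with
  | zero =>
    exact congrArg t (Subsingleton.elim _ _)
  | succ n ih =>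
    have : Fin.tail (fun i => Finsupp.single (y i) (1 : ℝ)) =
      fun i => Finsupp.single (Fin.tail y i) 1 := rfl
    rw [multilinearLift_succ, LinearMap.uncurryLeft_apply, this]
    simp only [Finsupp.lift_apply, Finsupp.sum_single_index, zero_smul, one_smul]
    rw [ih, Fin.cons_self_tail]

lemma multilinearMap_ext_single {n : ℕ} {f g : MultilinearMap ℝ (fun _ : Fin n => E →₀ ℝ) W}
    (h : ∀ y : Fin n → E, f (fun i => Finsupp.single (y i) 1) =
      g (fun i => Finsupp.single (y i) 1)) : f = g :=
  Module.Basis.ext_multilinear (fun _ => Finsupp.basisSingleOne) fun y => by simpa using h y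

/-- A multilinear map into a free module that is bounded by `1` on tuples of basis vectors is
bounded by `1` for the `ℓ¹`-norms. -/
lemma l1_multilinear_le {B : Type*} {n : ℕ}
    (f : MultilinearMap ℝ (fun _ : Fin n => E →₀ ℝ) (B →₀ ℝ))
    (h : ∀ y : Fin n → E, l1 (f fun i => Finsupp.single (y i) 1) ≤ 1) (ν : Fin n → E →₀ ℝ) :
    l1 (f ν) ≤ ∏ i, l1 (ν i) := by
  classical
  have hν : ν = fun i => ∑ e ∈ (ν i).support, ν i e • Finsupp.single e (1 : ℝ) := by
    funext i
    conv_lhs => rw [← Finsupp.sum_single (ν i), Finsupp.sum]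
    simp
  calc l1 (f ν)
      = l1 (∑ y ∈ Fintype.piFinset fun i => (ν i).support,
          (∏ i, ν i (y i)) • f fun i => Finsupp.single (y i) 1) := by
        conv_lhs => rw [hν, MultilinearMap.map_sum_finset]
        simp only [MultilinearMap.map_smul_univ]
    _ ≤ ∑ y ∈ Fintype.piFinset fun i => (ν i).support, ∏ i, |ν i (y i)| := by
        refine (l1_sum_le _ _).trans (Finset.sum_le_sum fun y _ => ?_)
        rw [l1_smul, Finset.abs_prod]
        exact mul_le_of_le_one_right (Finset.prod_nonneg fun _ _ => abs_nonneg _) (h y)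
    _ = ∏ i, l1 (ν i) :=
        (Finset.prod_univ_sum _ fun i e => |ν i e|).symm

/-- The antisymmetrized multilinear extension of a function on tuples. -/
def altLift (n : ℕ) (t : (Fin n → E) → W) : (E →₀ ℝ) [⋀^Fin n]→ₗ[ℝ] W :=
  ((n.factorial : ℝ)⁻¹) • MultilinearMap.alternatization (multilinearLift n t)

lemma altLift_single (n : ℕ) (t : (Fin n → E) → W) (y : Fin n → E) :
    altLift n t (fun i => Finsupp.single (y i) 1) =
      (n.factorial : ℝ)⁻¹ • ∑ π : Equiv.Perm (Fin n),
        ((Equiv.Perm.sign π : ℤ) : ℝ) • t (y ∘ π) := by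
  simp only [altLift, AlternatingMap.smul_apply, MultilinearMap.alternatization_apply,
    MultilinearMap.domDomCongr_apply, Int.cast_smul_eq_zsmul]
  congr 1
  refine Finset.sum_congr rfl fun π _ => ?_
  rw [multilinearLift_single n t (fun i => y (π i))]
  rfl

lemma l1_altLift_le {B : Type*} {n : ℕ} (t : (Fin n → E) → B) (ν : Fin n → E →₀ ℝ) :
    l1 (altLift n (fun y => Finsupp.single (t y) (1 : ℝ)) ν) ≤ ∏ i, l1 (ν i) := by
  refine l1_multilinear_le (altLift n fun y => Finsupp.single (t y) (1 : ℝ)).toMultilinearMap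
    (fun y => ?_) ν
  rw [AlternatingMap.coe_multilinearMap, altLift_single, l1_smul]
  have h := l1_sum_le Finset.univ fun π : Equiv.Perm (Fin n) =>
    ((Equiv.Perm.sign π : ℤ) : ℝ) • Finsupp.single (t (y ∘ π)) (1 : ℝ)
  have h1 (π : Equiv.Perm (Fin n)) : |((Equiv.Perm.sign π : ℤ) : ℝ)| = 1 := by
    rcases Int.units_eq_one_or (Equiv.Perm.sign π) with h | h <;> simp [h]
  simp only [l1_smul, l1_single, h1, abs_one, mul_one, Finset.sum_const, Finset.card_univ,
    Fintype.card_perm, Fintype.card_fin, nsmul_eq_mul] at h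
  rw [abs_of_nonneg (by positivity)]
  calc _ ≤ (n.factorial : ℝ)⁻¹ * n.factorial := by gcongr
    _ = 1 := inv_mul_cancel₀ (by positivity)

lemma altLift_one (t : (Fin 1 → E) → W) (ν : Fin 1 → E →₀ ℝ) :
    altLift 1 t ν = Finsupp.linearCombination ℝ (fun e => t fun _ => e) (ν 0) := by
  have : (altLift 1 t).toMultilinearMap = MultilinearMap.ofSubsingleton ℝ (E →₀ ℝ) W (0 : Fin 1)
      (Finsupp.linearCombination ℝ fun e => t fun _ => e) := by
    refine multilinearMap_ext_single fun y => ?_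
    rw [AlternatingMap.coe_multilinearMap, altLift_single, Fintype.sum_subsingleton _ 1]
    simp only [Nat.factorial_one, Nat.cast_one, inv_one, one_smul, Equiv.Perm.sign_one,
      Units.val_one, Int.cast_one, MultilinearMap.ofSubsingleton_apply_apply,
      Finsupp.linearCombination_single]
    congr 1
    funext i
    exact congrArg y (Subsingleton.elim _ _)
  exact congr($this ν)

/-- Composing with a linear map commutes with antisymmetrized extension. -/
lemma map_altLift {W' : Type*} [AddCommGroup W'] [Module ℝ W'] (g : W →ₗ[ℝ] W') (φ : E → E) {n : ℕ}
    (t : (Fin n → E) → W) (t' : (Fin n → E) → W') (h : ∀ y, g (t y) = t' (φ ∘ y))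
    (ν : Fin n → E →₀ ℝ) :
    g (altLift n t ν) = altLift n t' fun i => (ν i).mapDomain φ := by
  have : g.compMultilinearMap (altLift n t).toMultilinearMap =
      (altLift n t').toMultilinearMap.compLinearMap fun _ => Finsupp.lmapDomain ℝ ℝ φ := by
    refine multilinearMap_ext_single fun y => ?_
    simp only [LinearMap.compMultilinearMap_apply, AlternatingMap.coe_multilinearMap,
      MultilinearMap.compLinearMap_apply, Finsupp.lmapDomain_apply, Finsupp.mapDomain_single]
    rw [altLift_single, altLift_single n t' (fun i => φ (y i))]
    simp only [map_smul, map_sum, h]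
    rfl
  exact congr($this ν)

/-- The permutation that sends `i` to `j` and is `π` between their complements, both enumerated in
increasing order. -/
def permInsert {n : ℕ} (i j : Fin (n + 1)) (π : Equiv.Perm (Fin n)) : Equiv.Perm (Fin (n + 1)) :=
  j.cycleRange.symm * Equiv.Perm.decomposeFin.symm (0, π) * i.cycleRange

lemma permInsert_self {n : ℕ} (i j : Fin (n + 1)) (π : Equiv.Perm (Fin n)) :
    permInsert i j π i = j := by
  simp [permInsert]

lemma permInsert_succAbove {n : ℕ} (i j : Fin (n + 1)) (π : Equiv.Perm (Fin n)) (k : Fin n) :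
    permInsert i j π (i.succAbove k) = j.succAbove (π k) := by
  simp [permInsert]

lemma sign_permInsert {n : ℕ} (i j : Fin (n + 1)) (π : Equiv.Perm (Fin n)) :
    Equiv.Perm.sign (permInsert i j π) =
      (-1) ^ (i : ℕ) * ((-1) ^ (j : ℕ) * Equiv.Perm.sign π) := by
  simp [permInsert, Fin.sign_cycleRange, mul_comm]

lemma permInsert_bijective {n : ℕ} (i : Fin (n + 1)) :
    Function.Bijective fun p : Fin (n + 1) × Equiv.Perm (Fin n) => permInsert i p.1 p.2 := by
  rw [Fintype.bijective_iff_injective_and_card]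
  refine ⟨?_, by simp [Fintype.card_perm, Nat.factorial_succ]⟩
  rintro ⟨j, π⟩ ⟨j', π'⟩ h
  dsimp only at h
  obtain rfl : j = j' := by rw [← permInsert_self i j π, h, permInsert_self]
  simpa [permInsert] using h

/-- Antisymmetrization commutes with the boundary: the signed sum of all faces of all permutations
of a simplex is the signed sum of all permutations of all its faces. -/
lemma sum_sign_faces {n : ℕ} (g : (Fin n → Fin (n + 1)) → W) :
    ∑ π : Equiv.Perm (Fin (n + 1)), ((Equiv.Perm.sign π : ℤ) : ℝ) •
        ∑ i : Fin (n + 1), (-1 : ℝ) ^ (i : ℕ) • g (π ∘ i.succAbove) =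
      ((n + 1 : ℕ) : ℝ) • ∑ j : Fin (n + 1), (-1 : ℝ) ^ (j : ℕ) •
        ∑ π : Equiv.Perm (Fin n), ((Equiv.Perm.sign π : ℤ) : ℝ) • g (j.succAbove ∘ π) := by
  simp only [Finset.smul_sum]
  rw [Finset.sum_comm]
  have key (i : Fin (n + 1)) :
      ∑ π : Equiv.Perm (Fin (n + 1)), ((Equiv.Perm.sign π : ℤ) : ℝ) •
        (-1 : ℝ) ^ (i : ℕ) • g (π ∘ i.succAbove) =
      ∑ j : Fin (n + 1), ∑ π : Equiv.Perm (Fin n),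
        (-1 : ℝ) ^ (j : ℕ) • ((Equiv.Perm.sign π : ℤ) : ℝ) • g (j.succAbove ∘ π) := by
    rw [← Fintype.sum_prod_type', ← (permInsert_bijective i).sum_comp]
    refine Finset.sum_congr rfl fun p _ => ?_
    have h1 : permInsert i p.1 p.2 ∘ i.succAbove = p.1.succAbove ∘ p.2 :=
      funext fun k => permInsert_succAbove i p.1 p.2 k
    rw [h1, sign_permInsert, smul_smul, smul_smul]
    congr 1
    push_cast
    rw [mul_comm, ← mul_assoc, ← pow_add, Even.neg_one_pow ⟨_, rfl⟩, one_mul]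
  rw [Finset.sum_congr rfl fun i _ => key i, Finset.sum_const, Finset.card_univ, Fintype.card_fin,
    ← Nat.cast_smul_eq_nsmul ℝ]
  simp only [Finset.smul_sum]

/-- The boundary of the antisymmetrized extension of a family of simplices, compatible with faces,
evaluated on a tuple of finite measures: deleting a measure contributes its total mass. -/
lemma boundary_altLift {A B : Type*} {n : ℕ} (d : Fin (n + 1) → A → B) (s : (Fin (n + 1) → E) → A)
    (s' : (Fin n → E) → B) (h : ∀ i y, d i (s y) = s' (y ∘ i.succAbove))
    (ν : Fin (n + 1) → E →₀ ℝ) :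
    boundary d (altLift (n + 1) (fun y => Finsupp.single (s y) (1 : ℝ)) ν) =
      ∑ i : Fin (n + 1), (-1 : ℝ) ^ (i : ℕ) • ((ν i).sum fun _ r => r) •
        altLift n (fun y => Finsupp.single (s' y) (1 : ℝ)) (ν ∘ i.succAbove) := by
  let mass : (E →₀ ℝ) →ₗ[ℝ] ℝ := Finsupp.linearCombination ℝ fun _ => 1
  let T := (altLift n fun y => Finsupp.single (s' y) (1 : ℝ)).toMultilinearMap
  have : (boundary d).compMultilinearMap
      (altLift (n + 1) fun y => Finsupp.single (s y) (1 : ℝ)).toMultilinearMap =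
      ∑ i : Fin (n + 1), (-1 : ℝ) ^ (i : ℕ) • LinearMap.uncurryMid i (mass.smulRight T) := by
    refine multilinearMap_ext_single fun y => ?_
    have hT (i : Fin (n + 1)) : T (i.removeNth fun i => Finsupp.single (y i) 1) =
        (n.factorial : ℝ)⁻¹ • ∑ π : Equiv.Perm (Fin n), ((Equiv.Perm.sign π : ℤ) : ℝ) •
          Finsupp.single (s' (y ∘ (i.succAbove ∘ π))) (1 : ℝ) :=
      altLift_single n _ fun k => y (i.succAbove k)
    simp only [LinearMap.compMultilinearMap_apply, AlternatingMap.coe_multilinearMap,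
      sum_apply, smul_apply, LinearMap.uncurryMid_apply,
      LinearMap.smulRight_apply, mass, Finsupp.linearCombination_single, one_smul, hT,
      altLift_single, map_smul, map_sum, boundary_single, h]
    have := sum_sign_faces fun z => Finsupp.single (s' (y ∘ z)) (1 : ℝ)
    simp only [Function.comp_assoc] at this ⊢
    rw [this, smul_smul, Nat.factorial_succ, Nat.cast_mul, mul_inv, mul_right_comm,
      inv_mul_cancel₀ (by positivity), one_mul, Finset.smul_sum]
    exact Finset.sum_congr rfl fun i _ => smul_comm _ _ _
  have h2 := congr($this ν)
  simp only [LinearMap.compMultilinearMap_apply, AlternatingMap.coe_multilinearMap,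
    sum_apply, smul_apply, LinearMap.uncurryMid_apply,
    LinearMap.smulRight_apply, mass, Finsupp.linearCombination_apply, smul_eq_mul, mul_one] at h2
  exact h2

end Alternating

/-! ### Cones over singular simplices -/

section Cone

open scoped unitInterval

/-- A singular `m`-simplex of a space, as a continuous map on the standard simplex. -/
abbrev Simplex (m : ℕ) (Y : Type*) [TopologicalSpace Y] := C(stdSimplex ℝ (Fin (m + 1)), Y)

/-- The `i`-th face of a singular simplex. -/
def face {Y : Type*} [TopologicalSpace Y] {m : ℕ} (i : Fin (m + 2)) (τ : Simplex (m + 1) Y) :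
    Simplex m Y :=
  τ.comp ⟨stdSimplex.map i.succAbove, stdSimplex.continuous_map _⟩

lemma face_apply {Y : Type*} [TopologicalSpace Y] {m : ℕ} (i : Fin (m + 2))
    (τ : Simplex (m + 1) Y) (x) : face i τ x = τ (stdSimplex.map i.succAbove x) := rfl

/-- The presentation of the standard `(m + 1)`-simplex as the cone over its face opposite to the
vertex `0`; the parameter is `0` at the apex and `1` on that face. -/
def coneParam (m : ℕ) : C(stdSimplex ℝ (Fin (m + 1)) × I, stdSimplex ℝ (Fin (m + 2))) where
  toFun q := ⟨Fin.cons (1 - (q.2 : ℝ)) fun i => (q.2 : ℝ) * q.1 i, by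
    refine ⟨fun i => ?_, ?_⟩
    · refine Fin.cases ?_ (fun i => ?_) i
      · exact sub_nonneg.2 q.2.2.2
      · exact mul_nonneg q.2.2.1 (q.1.2.1 i)
    · rw [Fin.sum_univ_succ]
      simp only [Fin.cons_zero, Fin.cons_succ, ← Finset.mul_sum, stdSimplex.sum_eq_one]
      ring⟩
  continuous_toFun := by
    refine Continuous.subtype_mk (continuous_pi fun i => ?_) _
    refine Fin.cases ?_ (fun i => ?_) i
    · simp only [Fin.cons_zero]
      fun_prop
    · simp only [Fin.cons_succ]
      exact (continuous_subtype_val.comp continuous_snd).mul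
        ((continuous_apply i).comp (continuous_subtype_val.comp continuous_fst))

lemma coneParam_zero {m : ℕ} (q) : coneParam m q 0 = 1 - (q.2 : ℝ) := rfl

lemma coneParam_succ {m : ℕ} (q) (i : Fin (m + 1)) : coneParam m q i.succ = (q.2 : ℝ) * q.1 i := rfl

lemma coneParam_surjective (m : ℕ) : Function.Surjective (coneParam m) := by
  intro x
  have hx := stdSimplex.sum_eq_one x
  rw [Fin.sum_univ_succ] at hx
  have h0 : 0 ≤ x 0 := x.2.1 0
  have h1 : x 0 ≤ 1 := stdSimplex.le_one x 0
  by_cases h : x 0 = 1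
  · refine ⟨(stdSimplex.vertex 0, 0), ?_⟩
    have h' : ∑ i : Fin (m + 1), x i.succ = 0 := by linarith
    rw [Finset.sum_eq_zero_iff_of_nonneg fun i _ => x.2.1 i.succ] at h'
    ext i
    refine Fin.cases ?_ (fun i => ?_) i
    · simp [coneParam_zero, h]
    · simp [coneParam_succ, h' i (Finset.mem_univ i)]
  · have h2 : 0 < 1 - x 0 := by
      rcases h1.lt_or_eq with h1 | h1
      · linarith
      · exact absurd h1 h
    refine ⟨(⟨fun i => x i.succ / (1 - x 0), fun i => div_nonneg (x.2.1 _) h2.le, ?_⟩,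
      ⟨1 - x 0, h2.le, by linarith⟩), ?_⟩
    · rw [← Finset.sum_div, div_eq_one_iff_eq h2.ne']
      linarith
    · ext i
      refine Fin.cases ?_ (fun i => ?_) i
      · simp [coneParam_zero]
      · rw [coneParam_succ]
        exact mul_div_cancel₀ _ h2.ne'

lemma isQuotientMap_coneParam (m : ℕ) : Topology.IsQuotientMap (coneParam m) :=
  (coneParam m).continuous.isClosedMap.isQuotientMap (coneParam m).continuous
    (coneParam_surjective m)

lemma map_succAbove_apply_succAbove {m : ℕ} (i : Fin (m + 1)) (y : stdSimplex ℝ (Fin m))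
    (k : Fin m) : stdSimplex.map i.succAbove y (i.succAbove k) = y k := by
  classical
  rw [stdSimplex.map_coe, FunOnFinite.linearMap_apply_apply]
  rw [Finset.sum_eq_single k]
  · simp +contextual
  · simp

lemma map_succAbove_apply_self {m : ℕ} (i : Fin (m + 1)) (y : stdSimplex ℝ (Fin m)) :
    stdSimplex.map i.succAbove y i = 0 := by
  classical
  rw [stdSimplex.map_coe, FunOnFinite.linearMap_apply_apply]
  exact Finset.sum_eq_zero fun k hk => absurd (Finset.mem_filter.1 hk).2 (Fin.succAbove_ne i k)

/-- The face opposite to the vertex `0` is the base of the cone. -/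
lemma map_succAbove_zero {m : ℕ} (y : stdSimplex ℝ (Fin (m + 1))) :
    stdSimplex.map (Fin.succAbove 0) y = coneParam m (y, 1) := by
  ext j
  refine Fin.cases ?_ (fun j => ?_) j
  · rw [map_succAbove_apply_self, coneParam_zero]
    simp
  · have := map_succAbove_apply_succAbove 0 y j
    rw [Fin.zero_succAbove] at this
    rw [this, coneParam_succ]
    simp

/-- The other faces of a cone are the cones over the faces of its base. -/
lemma map_succAbove_succ {m : ℕ} (i : Fin (m + 2)) (y : stdSimplex ℝ (Fin (m + 1))) (t : I) :
    stdSimplex.map i.succ.succAbove (coneParam m (y, t)) =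
      coneParam (m + 1) (stdSimplex.map i.succAbove y, t) := by
  ext j
  refine Fin.cases ?_ (fun j => ?_) j
  · rw [← Fin.succ_succAbove_zero i, map_succAbove_apply_succAbove, Fin.succ_succAbove_zero,
      coneParam_zero, coneParam_zero]
  · rw [coneParam_succ]
    refine Fin.succAboveCases i ?_ (fun k => ?_) j
    · rw [map_succAbove_apply_self, map_succAbove_apply_self, mul_zero]
    · rw [← Fin.succ_succAbove_succ, map_succAbove_apply_succAbove, map_succAbove_apply_succAbove,
        coneParam_succ]

/-- The vertex `0` of the standard `1`-simplex is the apex of the cone. -/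
lemma map_succAbove_one (y : stdSimplex ℝ (Fin 1)) :
    stdSimplex.map (Fin.succAbove (1 : Fin 2)) y = coneParam 0 (y, 0) := by
  ext j
  refine Fin.cases ?_ (fun j => ?_) j
  · have := map_succAbove_apply_succAbove 1 y 0
    rw [Fin.one_succAbove_zero] at this
    rw [this, coneParam_zero]
    simp
  · obtain rfl : j = 0 := Subsingleton.elim _ _
    rw [coneParam_succ]
    exact (map_succAbove_apply_self 1 y).trans (by simp)

variable (Y : Type*) [TopologicalSpace Y]

/-- A choice, for every point `e` of a space, of a contraction of the space to `e`. It runs from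
the constant map at time `0` to the identity at time `1`, and need not fix `e`. -/
structure Contraction where
  /-- The contraction to the point `e`. -/
  H (e : Y) : C(Y × I, Y)
  H_zero (e x : Y) : H e (x, 0) = e
  H_one (e x : Y) : H e (x, 1) = x

variable {Y} (C : Contraction Y)

namespace Contraction

/-- The cone is well defined at its apex, where the coordinate on the base is undetermined, because
the contraction is constant at time `0`. -/
lemma cone_factorsThrough {m : ℕ} (e : Y) (τ : Simplex m Y) : Function.FactorsThrough
    ((C.H e).comp (τ.prodMap (ContinuousMap.id I))) (coneParam m) := by
  rintro ⟨y, t⟩ ⟨y', t'⟩ h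
  have h0 : t = t' := by
    have := DFunLike.congr_fun h 0
    rw [coneParam_zero, coneParam_zero] at this
    exact Subtype.ext (by linarith)
  subst h0
  by_cases ht : t = 0
  · simp [ht, C.H_zero]
  · have : y = y' := by
      ext i
      have := DFunLike.congr_fun h i.succ
      rw [coneParam_succ, coneParam_succ] at this
      exact mul_left_cancel₀ (fun h => ht (Subtype.ext h)) this
    rw [this]

/-- The cone with apex `e` over a singular simplex, obtained by contracting the simplex to `e`. -/
def cone {m : ℕ} (e : Y) (τ : Simplex m Y) : Simplex (m + 1) Y :=
  (isQuotientMap_coneParam m).lift _ (C.cone_factorsThrough e τ)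

lemma cone_coneParam {m : ℕ} (e : Y) (τ : Simplex m Y) (y t) :
    C.cone e τ (coneParam m (y, t)) = C.H e (τ y, t) :=
  congr($((isQuotientMap_coneParam m).lift_comp _ (C.cone_factorsThrough e τ)) (y, t))

lemma simplex_ext {m : ℕ} {τ τ' : Simplex (m + 1) Y}
    (h : ∀ y t, τ (coneParam m (y, t)) = τ' (coneParam m (y, t))) : τ = τ' := by
  ext x
  obtain ⟨⟨y, t⟩, rfl⟩ := coneParam_surjective m x
  exact h y t

lemma face_zero_cone {m : ℕ} (e : Y) (τ : Simplex m Y) : face 0 (C.cone e τ) = τ := by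
  ext y
  rw [face_apply, map_succAbove_zero, cone_coneParam, C.H_one]

lemma face_succ_cone {m : ℕ} (e : Y) (τ : Simplex (m + 1) Y) (i : Fin (m + 2)) :
    face i.succ (C.cone e τ) = C.cone e (face i τ) :=
  simplex_ext fun y t => by
    rw [face_apply, map_succAbove_succ, cone_coneParam, cone_coneParam, face_apply]

lemma face_one_cone (e : Y) (τ : Simplex 0 Y) :
    face 1 (C.cone e τ) = ContinuousMap.const _ e := by
  ext y
  rw [face_apply, map_succAbove_one, cone_coneParam, C.H_zero]
  rfl

/-- A self-map is compatible with the chosen contractions if it carries the contraction to `e` to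
the contraction to the image of `e`. -/
def Commutes (g : C(Y, Y)) : Prop := ∀ e x t, C.H (g e) (g x, t) = g (C.H e (x, t))

variable {C}

lemma Commutes.cone {g : C(Y, Y)} (hg : C.Commutes g) {m : ℕ} (e : Y) (τ : Simplex m Y) :
    C.cone (g e) (g.comp τ) = g.comp (C.cone e τ) :=
  simplex_ext fun y t => by
    rw [cone_coneParam, ContinuousMap.comp_apply, ContinuousMap.comp_apply, cone_coneParam, hg]

variable (C)

/-- The straight simplex with given vertices: the iterated cone over its vertices. -/
def straight (m : ℕ) : (Fin (m + 1) → Y) → Simplex m Y :=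
  Nat.rec (fun y => ContinuousMap.const _ (y 0))
    (fun _ ih y => C.cone (y 0) (ih (Fin.tail y))) m

lemma straight_zero (y : Fin 1 → Y) : C.straight 0 y = ContinuousMap.const _ (y 0) := rfl

lemma straight_succ (m : ℕ) (y : Fin (m + 2) → Y) :
    C.straight (m + 1) y = C.cone (y 0) (C.straight m (Fin.tail y)) := rfl

lemma face_straight {m : ℕ} (i : Fin (m + 2)) (y : Fin (m + 2) → Y) :
    face i (C.straight (m + 1) y) = C.straight m (y ∘ i.succAbove) := by
  induction m with
  | zero =>
    rw [straight_succ, straight_zero, straight_zero]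
    refine Fin.cases ?_ (fun i => ?_) i
    · rw [face_zero_cone]
      rfl
    · obtain rfl : i = 0 := Subsingleton.elim _ _
      exact C.face_one_cone _ _
  | succ m ih =>
    refine Fin.cases ?_ (fun i => ?_) i
    · rw [straight_succ, face_zero_cone]
      rfl
    · rw [straight_succ, face_succ_cone, ih, straight_succ]
      congr 2
      funext k
      simp [Fin.tail]

variable {C}

lemma Commutes.straight {g : C(Y, Y)} (hg : C.Commutes g) {m : ℕ} (y : Fin (m + 1) → Y) :
    C.straight m (g ∘ y) = g.comp (C.straight m y) := by
  induction m with
  | zero => rfl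
  | succ m ih =>
    rw [straight_succ, straight_succ, ← hg.cone, ← ih]
    rfl

end Contraction

end Cone

/-! ### Covering maps with contractible total space -/

section Covering

open scoped unitInterval

variable {E Z : Type*} [TopologicalSpace E] [TopologicalSpace Z] {p : E → Z}

lemma exists_homotopy_const_id (A : Type*) [TopologicalSpace A] [ContractibleSpace A] (a : A) :
    Nonempty ((ContinuousMap.const A a).Homotopy (ContinuousMap.id A)) := by
  obtain ⟨b, hb⟩ := id_nullhomotopic A
  exact ((ContinuousMap.homotopic_const_iff.2 (PathConnectedSpace.joined a b)).trans hb.symm)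

/-- Maps from a contractible space lift through a covering map. The space need not be locally
path-connected: the lift is obtained from the homotopy lifting property. -/
lemma exists_lift_of_contractible (cov : IsCoveringMap p) {A : Type*} [TopologicalSpace A]
    [ContractibleSpace A] (φ : C(A, Z)) (a : A) (e : E) (he : p e = φ a) :
    ∃ τ : C(A, E), (∀ x, p (τ x) = φ x) ∧ τ a = e := by
  obtain ⟨F⟩ := exists_homotopy_const_id A a
  let γ : Path (φ a) (φ a) :=
    { toFun t := φ (F (t, a))
      continuous_toFun := by fun_prop
      source' := by simp
      target' := by simp }
  -- The track of `a` under the contraction need not be constant; the lift starts at the point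
  -- which is transported to `e` along it.
  obtain ⟨⟨e', he'⟩, h⟩ := (cov.monodromy_bijective (Path.Homotopic.Quotient.mk γ)).2 ⟨e, he⟩
  have h0 (x : A) : (φ.comp F.toContinuousMap) (0, x) = p (ContinuousMap.const A e' x) := by
    simpa using he'.symm
  let L := cov.liftHomotopy (φ.comp F.toContinuousMap) (ContinuousMap.const A e') h0
  refine ⟨⟨fun x => L (1, x), by fun_prop⟩, fun x => ?_, ?_⟩
  · exact (congr_fun (cov.liftHomotopy_lifts _ _ h0) (1, x)).trans (by simp)
  · exact congrArg Subtype.val h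

/-- The total space of a covering map with contractible total space is contracted to each of its
points compatibly with all deck transformations. -/
lemma exists_equivariant_contraction (cov : IsCoveringMap p) [ContractibleSpace E]
    (hp : Function.Surjective p) :
    ∃ C : Contraction E, ∀ g : C(E, E), (∀ x, p (g x) = p x) → C.Commutes g := by
  have ex (e e' : E) (h : p e' = p e) : ∃ g : C(E, E), (∀ x, p (g x) = p x) ∧ g e = e' :=
    exists_lift_of_contractible cov ⟨p, cov.continuous⟩ e e' h
  have uniq (g g' : C(E, E)) (hg : ∀ x, p (g x) = p x) (hg' : ∀ x, p (g' x) = p x) (e : E)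
      (h : g e = g' e) : g = g' :=
    DFunLike.coe_injective <| cov.eq_of_comp_eq g.continuous g'.continuous
      (funext fun x => (hg x).trans (hg' x).symm) e h
  -- Every orbit gets a representative `q e`, moved to `e` by `a e` and reached from `e` by `b e`.
  let q (e : E) : E := Function.surjInv hp (p e)
  have hq (e : E) : p (q e) = p e := Function.surjInv_eq hp (p e)
  choose a ha ha' using fun e => ex (q e) e (hq e).symm
  choose b hb hb' using fun e => ex e (q e) (hq e)
  let F (e : E) := (exists_homotopy_const_id E e).some
  have hab (e : E) : (a e).comp (b e) = ContinuousMap.id E :=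
    uniq _ _ (by simp [ha, hb]) (by simp) e (by simp [ha', hb'])
  refine ⟨⟨fun e => ⟨fun x => a e (F (q e) (x.2, b e x.1)), by fun_prop⟩,
    fun e x => ?_, fun e x => ?_⟩, fun g hg e x t => ?_⟩
  · simp [ha']
  · simpa using congr($(hab e) x)
  · have hqg : q (g e) = q e := by simp only [q, hg]
    have h1 : a (g e) = g.comp (a e) := by
      refine uniq _ _ (ha _) (by simp [hg, ha]) (q e) ?_
      rw [← hqg, ha', hqg, ContinuousMap.comp_apply, ha']
    have h2 : (b (g e)).comp g = b e := by
      refine uniq _ _ (by simp [hg, hb]) (hb e) e ?_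
      rw [ContinuousMap.comp_apply, hb', hb', hqg]
    change a (g e) (F (q (g e)) (t, b (g e) (g x))) = g (a e (F (q e) (t, b e x)))
    rw [hqg, h1, ← h2]
    rfl

variable (cov : IsCoveringMap p)

/-- The monodromy action of `π₁(Z, z₀)` on the fibre over `z₀`, extended to the total space by the
trivial action on the other fibres. -/
def transport (z₀ : Z) (γ : FundamentalGroup Z z₀) (e : E) : E :=
  open scoped Classical in if h : p e = z₀ then cov.monodromy γ ⟨e, h⟩ else e

variable {z₀ : Z}

lemma transport_of_eq {e : E} (h : p e = z₀) (γ : FundamentalGroup Z z₀) :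
    transport cov z₀ γ e = cov.monodromy γ ⟨e, h⟩ := dif_pos h

lemma map_transport (γ : FundamentalGroup Z z₀) (e : E) : p (transport cov z₀ γ e) = p e := by
  by_cases h : p e = z₀
  · rw [transport_of_eq cov h, h]
    exact (cov.monodromy γ ⟨e, h⟩).2
  · rw [transport, dif_neg h]

/-- Transport is a left action: a product of loops in `π₁` runs through its right factor first. -/
lemma transport_mul (γ γ' : FundamentalGroup Z z₀) (e : E) :
    transport cov z₀ (γ * γ') e = transport cov z₀ γ (transport cov z₀ γ' e) := by
  by_cases h : p e = z₀
  · rw [transport_of_eq cov h, transport_of_eq cov ((map_transport cov γ' e).trans h)]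
    simp only [transport_of_eq cov h]
    exact congrArg Subtype.val (cov.monodromy_trans_apply γ' γ ⟨e, h⟩)
  · simp [transport, h]

lemma transport_one (e : E) : transport cov z₀ 1 e = e := by
  by_cases h : p e = z₀
  · rw [transport_of_eq cov h]
    exact congr(($(cov.monodromy_refl) ⟨e, h⟩ : p ⁻¹' {z₀}).1)
  · simp [transport, h]

/-- Transport along a loop ends where a lift of the loop ends. -/
lemma transport_mk {x y : E} (δ : Path x y) (γ : Path z₀ z₀) (h : ∀ t, p (δ t) = γ t) :
    transport cov z₀ (FundamentalGroup.fromPath (Path.Homotopic.Quotient.mk γ)) x = y := by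
  have hx : p x = z₀ := by simpa using h 0
  rw [transport_of_eq cov hx]
  have : (δ : C(I, E)) = cov.liftPath γ x (γ.source.trans hx.symm) :=
    (cov.eq_liftPath_iff' _).2 ⟨funext h, δ.source⟩
  exact congr($this 1).symm.trans δ.target

/-- Monodromy commutes with deck transformations. -/
lemma transport_deck {g : C(E, E)} (hg : ∀ x, p (g x) = p x) (γ : FundamentalGroup Z z₀) (e : E) :
    transport cov z₀ γ (g e) = g (transport cov z₀ γ e) := by
  by_cases h : p e = z₀
  · obtain ⟨γ, rfl⟩ : ∃ γ' : Path z₀ z₀,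
        γ = FundamentalGroup.fromPath (Path.Homotopic.Quotient.mk γ') := by
      obtain ⟨γ'⟩ := γ
      exact ⟨γ', rfl⟩
    rw [transport_of_eq cov h]
    let Γ := cov.liftPath γ e (γ.source.trans h.symm)
    let δ : Path (g e) (g (Γ 1)) :=
      { toFun t := g (Γ t)
        continuous_toFun := by fun_prop
        source' := by rw [cov.liftPath_zero]
        target' := rfl }
    exact transport_mk cov δ γ fun t => (hg _).trans (congr_fun (cov.liftPath_lifts _ _ _) t)
  · simp [transport, h, hg]

/-- A path whose projection is a null-homotopic loop is itself a loop. -/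
lemma eq_of_isNullHomotopicLoop {E Z : Type u} [TopologicalSpace E] [TopologicalSpace Z] {p : E → Z}
    (cov : IsCoveringMap p) {x y : E} (δ : Path x y) {a b : Z} (γ : Path a b)
    (h : ∀ t, p (δ t) = γ t) (hγ : IsNullHomotopicLoop γ) : x = y := by
  obtain ⟨rfl, hγ⟩ := hγ
  have h1 := transport_mk cov δ γ h
  have h2 : Path.Homotopic.Quotient.mk γ = Path.Homotopic.Quotient.refl a :=
    Path.Homotopic.Quotient.eq.2 hγ
  rw [h2] at h1
  exact (transport_one cov x).symm.trans h1

lemma IsNullHomotopicLoop.map {X Z : Type u} [TopologicalSpace X] [TopologicalSpace Z]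
    {x y : X} {γ : Path x y} (hγ : IsNullHomotopicLoop γ) (f : C(X, Z)) :
    IsNullHomotopicLoop (γ.map f.continuous) := by
  obtain ⟨rfl, hγ⟩ := hγ
  exact ⟨rfl, hγ.map f⟩

end Covering

/-! ### The chain homotopy to straightened chains -/

section Straightening

variable {Y : Type*} [TopologicalSpace Y] (C : Contraction Y)

/-- The cone over a singular chain. -/
abbrev coneChain {m : ℕ} (e : Y) : (Simplex m Y →₀ ℝ) →ₗ[ℝ] (Simplex (m + 1) Y →₀ ℝ) :=
  Finsupp.lmapDomain ℝ ℝ (C.cone e)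

/-- The boundary of singular chains. -/
abbrev singularBoundary (m : ℕ) (Y : Type*) [TopologicalSpace Y] :
    (Simplex (m + 1) Y →₀ ℝ) →ₗ[ℝ] (Simplex m Y →₀ ℝ) :=
  boundary face

lemma boundary_coneChain_zero (e : Y) (c : Simplex 0 Y →₀ ℝ) :
    singularBoundary 0 Y (coneChain C e c) =
      c - (c.sum fun _ r => r) • Finsupp.single (ContinuousMap.const _ e) 1 := by
  induction c using Finsupp.induction_linear with
  | zero => simp
  | add c₁ c₂ h₁ h₂ =>
    rw [map_add, map_add, h₁, h₂, Finsupp.sum_add_index' (by simp) (by simp), add_smul]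
    abel
  | single τ r =>
    rw [Finsupp.lmapDomain_apply, Finsupp.mapDomain_single, boundary_single, Fin.sum_univ_two,
      C.face_zero_cone, C.face_one_cone, Finsupp.sum_single_index rfl]
    simp [sub_eq_add_neg]

/-- Coning off is a contracting homotopy in positive degrees. -/
lemma boundary_coneChain_succ {m : ℕ} (e : Y) (c : Simplex (m + 1) Y →₀ ℝ) :
    singularBoundary (m + 1) Y (coneChain C e c) = c - coneChain C e (singularBoundary m Y c) := by
  induction c using Finsupp.induction_linear with
  | zero => simp
  | add c₁ c₂ h₁ h₂ =>
    rw [map_add, map_add, h₁, h₂, map_add, map_add]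
    abel
  | single τ r =>
    rw [Finsupp.lmapDomain_apply, Finsupp.mapDomain_single, boundary_single, boundary_single,
      Fin.sum_univ_succ, C.face_zero_cone, map_sum]
    simp only [C.face_succ_cone, map_smul, Finsupp.lmapDomain_apply, Finsupp.mapDomain_single,
      Fin.val_zero, pow_zero, one_smul, Fin.val_succ, pow_succ, mul_neg, mul_one, neg_smul,
      Finset.sum_neg_distrib, sub_eq_add_neg]

variable {V : Type*} (K : V → Y → Y →₀ ℝ)

/-- A singular simplex whose vertices carry labels in `V`. -/
abbrev LabelledSimplex (m : ℕ) (V Y : Type*) [TopologicalSpace Y] :=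
  (Fin (m + 1) → V) × Simplex m Y

/-- The `i`-th face of a labelled singular simplex. -/
def labelledFace {m : ℕ} (i : Fin (m + 2)) (x : LabelledSimplex (m + 1) V Y) :
    LabelledSimplex m V Y :=
  (x.1 ∘ i.succAbove, face i x.2)

/-- The simplicial identities, in the form required by `boundary_boundary`. -/
lemma labelledFace_labelledFace {m : ℕ} (i : Fin (m + 3)) (j : Fin (m + 2))
    (x : LabelledSimplex (m + 2) V Y) :
    labelledFace (j.predAbove i) (labelledFace (i.succAbove j) x) =
      labelledFace j (labelledFace i x) := by
  have h : (i.succAbove j).succAbove ∘ (j.predAbove i).succAbove = i.succAbove ∘ j.succAbove :=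
    funext fun k => Fin.succAbove_succAbove_succAbove_predAbove i j k
  refine Prod.ext ?_ ?_
  · exact congr(x.1 ∘ $h)
  · ext y
    simp only [labelledFace, face_apply, stdSimplex.map_comp_apply]
    exact congr(x.2 (stdSimplex.map $h y))

/-- The boundary of chains of labelled simplices. -/
abbrev labelledBoundary (m : ℕ) (V Y : Type*) [TopologicalSpace Y] :
    (LabelledSimplex (m + 1) V Y →₀ ℝ) →ₗ[ℝ] (LabelledSimplex m V Y →₀ ℝ) :=
  boundary labelledFace

/-- The tuple of measures that `K` assigns to the vertices of a labelled simplex. -/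
def vertexMeasures {m : ℕ} (x : LabelledSimplex m V Y) (i : Fin (m + 1)) : Y →₀ ℝ :=
  K (x.1 i) (x.2 (stdSimplex.vertex i))

/-- The smeared straightening of a labelled simplex: every vertex is moved at random, independently
of the other vertices and with the law that `K` assigns to it, and the straight simplex on the new
vertices is antisymmetrized. -/
def smear (m : ℕ) (x : LabelledSimplex m V Y) : Simplex m Y →₀ ℝ :=
  altLift (m + 1) (fun y => Finsupp.single (C.straight m y) (1 : ℝ)) (vertexMeasures K x)

lemma vertexMeasures_labelledFace {m : ℕ} (x : LabelledSimplex (m + 1) V Y) (i : Fin (m + 2)) :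
    vertexMeasures K (labelledFace i x) = vertexMeasures K x ∘ i.succAbove := by
  funext k
  simp only [vertexMeasures, labelledFace, face_apply, Function.comp_apply, stdSimplex.map_vertex]

variable {K}

/-- Smeared straightening is a chain map. -/
lemma boundary_smear (hK : ∀ v e, ((K v e).sum fun _ r => r) = 1) {m : ℕ}
    (x : LabelledSimplex (m + 1) V Y) :
    singularBoundary m Y (smear C K (m + 1) x) =
      Finsupp.linearCombination ℝ (smear C K m) (labelledBoundary m V Y (Finsupp.single x 1)) := by
  rw [smear, singularBoundary, boundary_altLift _ _ (C.straight m) C.face_straight,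
    labelledBoundary, boundary_single, map_sum]
  refine Finset.sum_congr rfl fun i _ => ?_
  rw [vertexMeasures, hK, one_smul, map_smul, Finsupp.linearCombination_single, one_smul, smear,
    vertexMeasures_labelledFace]

lemma l1_smear_le_one (hK1 : ∀ v e, l1 (K v e) ≤ 1) {m : ℕ} (x : LabelledSimplex m V Y) :
    l1 (smear C K m x) ≤ 1 :=
  (l1_altLift_le _ _).trans (Finset.prod_le_one (fun _ _ => l1_nonneg _) fun _ _ => hK1 _ _)

/-- Smearing almost kills a simplex with two vertices whose laws almost agree, because
it is alternating in these laws. -/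
lemma l1_smear_le (hK1 : ∀ v e, l1 (K v e) ≤ 1) {m : ℕ} (x : LabelledSimplex m V Y)
    {i j : Fin (m + 1)} (hij : i ≠ j) :
    l1 (smear C K m x) ≤ l1 (vertexMeasures K x j - vertexMeasures K x i) := by
  set ν := vertexMeasures K x with hν
  set T := altLift (m + 1) fun y => Finsupp.single (C.straight m y) (1 : ℝ) with hT
  have h : smear C K m x = T (Function.update ν j (ν j - ν i)) := by
    rw [T.map_update_sub, Function.update_eq_self, T.map_update_self _ hij.symm, sub_zero]
    rfl
  rw [h]
  refine (l1_altLift_le _ _).trans ?_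
  rw [Fintype.prod_eq_mul_prod_compl j, Function.update_self]
  refine mul_le_of_le_one_right (l1_nonneg _) (Finset.prod_le_one (fun _ _ => l1_nonneg _) ?_)
  intro k hk
  rw [Function.update_of_ne (by simpa using hk)]
  exact hK1 _ _

variable (K)

/-- The difference between the smeared straightening and the simplex itself. -/
def smearSub (m : ℕ) (x : LabelledSimplex m V Y) : Simplex m Y →₀ ℝ :=
  smear C K m x - Finsupp.single x.2 1

/-- The chain homotopy from the identity to smeared straightening. In each degree, the cycle that
has to be bounded is coned off from the first vertex of the simplex. -/
def smearHomotopy (m : ℕ) : LabelledSimplex m V Y → Simplex (m + 1) Y →₀ ℝ :=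
  Nat.rec (fun x => coneChain C (x.2 (stdSimplex.vertex 0)) (smearSub C K 0 x))
    (fun m ih x => coneChain C (x.2 (stdSimplex.vertex 0)) (smearSub C K (m + 1) x -
      Finsupp.linearCombination ℝ ih (labelledBoundary m V Y (Finsupp.single x 1)))) m

lemma smearHomotopy_zero (x : LabelledSimplex 0 V Y) :
    smearHomotopy C K 0 x = coneChain C (x.2 (stdSimplex.vertex 0)) (smearSub C K 0 x) := rfl

lemma smearHomotopy_succ {m : ℕ} (x : LabelledSimplex (m + 1) V Y) :
    smearHomotopy C K (m + 1) x = coneChain C (x.2 (stdSimplex.vertex 0)) (smearSub C K (m + 1) x -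
      Finsupp.linearCombination ℝ (smearHomotopy C K m)
        (labelledBoundary m V Y (Finsupp.single x 1))) := rfl

variable {K}

lemma boundary_smearSub (hK : ∀ v e, ((K v e).sum fun _ r => r) = 1) {m : ℕ}
    (x : LabelledSimplex (m + 1) V Y) :
    singularBoundary m Y (smearSub C K (m + 1) x) =
      Finsupp.linearCombination ℝ (smearSub C K m)
        (labelledBoundary m V Y (Finsupp.single x 1)) := by
  rw [smearSub, map_sub, boundary_smear C hK, boundary_single, boundary_single, map_sum, map_sum,
    ← Finset.sum_sub_distrib]
  refine Finset.sum_congr rfl fun i _ => ?_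
  rw [map_smul, map_smul, Finsupp.linearCombination_single, Finsupp.linearCombination_single,
    one_smul, one_smul, ← smul_sub]
  rfl

lemma boundary_smearHomotopy_zero (hK : ∀ v e, ((K v e).sum fun _ r => r) = 1)
    (x : LabelledSimplex 0 V Y) :
    singularBoundary 0 Y (smearHomotopy C K 0 x) = smearSub C K 0 x := by
  rw [smearHomotopy_zero, boundary_coneChain_zero]
  have h : (Finsupp.linearCombination ℝ fun _ : Simplex 0 Y => (1 : ℝ)) (smear C K 0 x) = 1 := by
    refine Eq.trans ?_ (hK (x.1 0) (x.2 (stdSimplex.vertex 0)))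
    rw [smear, altLift_one, Finsupp.linearCombination_apply _ (vertexMeasures K x 0), map_finsuppSum]
    simp [vertexMeasures]
  have h' : ((smearSub C K 0 x).sum fun _ r => r) = 0 := by
    have : ((smearSub C K 0 x).sum fun _ r => r) =
        Finsupp.linearCombination ℝ (fun _ : Simplex 0 Y => (1 : ℝ)) (smearSub C K 0 x) := by
      simp [Finsupp.linearCombination_apply]
    rw [this, smearSub, map_sub, h]
    simp
  rw [h', zero_smul, sub_zero]

/-- The homotopy formula holds for a simplex as soon as the chain that is coned off is a cycle. -/
lemma boundary_smearHomotopy_succ_of (hK : ∀ v e, ((K v e).sum fun _ r => r) = 1) {m : ℕ}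
    (x : LabelledSimplex (m + 1) V Y)
    (h : singularBoundary m Y (Finsupp.linearCombination ℝ (smearHomotopy C K m)
      (labelledBoundary m V Y (Finsupp.single x 1))) = Finsupp.linearCombination ℝ (smearSub C K m)
        (labelledBoundary m V Y (Finsupp.single x 1))) :
    singularBoundary (m + 1) Y (smearHomotopy C K (m + 1) x) = smearSub C K (m + 1) x -
      Finsupp.linearCombination ℝ (smearHomotopy C K m)
        (labelledBoundary m V Y (Finsupp.single x 1)) := by
  rw [smearHomotopy_succ, boundary_coneChain_succ, map_sub, boundary_smearSub C hK, h, sub_self,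
    map_zero, sub_zero]

/-- The chain that is coned off is a cycle, by the homotopy formula for the faces. -/
lemma boundary_linearCombination_smearHomotopy (hK : ∀ v e, ((K v e).sum fun _ r => r) = 1) {m : ℕ}
    (x : LabelledSimplex (m + 1) V Y) :
    singularBoundary m Y (Finsupp.linearCombination ℝ (smearHomotopy C K m)
      (labelledBoundary m V Y (Finsupp.single x 1))) = Finsupp.linearCombination ℝ (smearSub C K m)
        (labelledBoundary m V Y (Finsupp.single x 1)) := by
  induction m with
  | zero =>
    have h : singularBoundary 0 Y ∘ₗ Finsupp.linearCombination ℝ (smearHomotopy C K 0) =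
        Finsupp.linearCombination ℝ (smearSub C K 0) :=
      Finsupp.lhom_ext' fun y => LinearMap.ext_ring <| by
        simpa using boundary_smearHomotopy_zero C hK y
    exact congr($h _)
  | succ m ih =>
    have h : singularBoundary (m + 1) Y ∘ₗ Finsupp.linearCombination ℝ (smearHomotopy C K (m + 1)) =
        Finsupp.linearCombination ℝ (smearSub C K (m + 1)) -
          Finsupp.linearCombination ℝ (smearHomotopy C K m) ∘ₗ labelledBoundary m V Y :=
      Finsupp.lhom_ext' fun y => LinearMap.ext_ring <| by
        simpa using boundary_smearHomotopy_succ_of C hK y (ih y)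
    refine congr($h _).trans ?_
    rw [LinearMap.sub_apply, LinearMap.comp_apply,
      boundary_boundary _ _ labelledFace_labelledFace, map_zero, sub_zero]

/-- The homotopy formula. -/
lemma boundary_smearHomotopy_succ (hK : ∀ v e, ((K v e).sum fun _ r => r) = 1) {m : ℕ}
    (x : LabelledSimplex (m + 1) V Y) :
    singularBoundary (m + 1) Y (smearHomotopy C K (m + 1) x) = smearSub C K (m + 1) x -
      Finsupp.linearCombination ℝ (smearHomotopy C K m)
        (labelledBoundary m V Y (Finsupp.single x 1)) :=
  boundary_smearHomotopy_succ_of C hK x (boundary_linearCombination_smearHomotopy C hK x)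

/-! ### Equivariance and descent to the base -/

/-- The action of a self-map on labelled simplices. -/
def LabelledSimplex.map {m : ℕ} (g : C(Y, Y)) (x : LabelledSimplex m V Y) :
    LabelledSimplex m V Y :=
  (x.1, g.comp x.2)

/-- A self-map that is compatible with the contractions and with the measures `K`. -/
structure IsSymmetry (C : Contraction Y) (K : V → Y → Y →₀ ℝ) (g : C(Y, Y)) : Prop where
  commutes : C.Commutes g
  measure (v : V) (e : Y) : K v (g e) = (K v e).mapDomain g

variable {C} {g : C(Y, Y)}

lemma IsSymmetry.smear (hg : IsSymmetry C K g) {m : ℕ} (x : LabelledSimplex m V Y) :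
    smear C K m (x.map g) = (smear C K m x).mapDomain g.comp := by
  have h : vertexMeasures K (x.map g) = fun i => (vertexMeasures K x i).mapDomain g :=
    funext fun i => hg.measure _ _
  rw [AmenableReduction.smear, AmenableReduction.smear, h, ← Finsupp.lmapDomain_apply ℝ ℝ]
  refine (map_altLift _ _ _ _ (fun y => ?_) _).symm
  rw [Finsupp.lmapDomain_apply, Finsupp.mapDomain_single, hg.commutes.straight]

lemma IsSymmetry.smearSub (hg : IsSymmetry C K g) {m : ℕ} (x : LabelledSimplex m V Y) :
    smearSub C K m (x.map g) = (smearSub C K m x).mapDomain g.comp := by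
  rw [AmenableReduction.smearSub, AmenableReduction.smearSub, hg.smear,
    ← Finsupp.lmapDomain_apply ℝ ℝ, ← Finsupp.lmapDomain_apply ℝ ℝ, map_sub,
    Finsupp.lmapDomain_apply ℝ ℝ _ (Finsupp.single _ _), Finsupp.mapDomain_single]
  rfl

lemma coneChain_mapDomain (hg : IsSymmetry C K g) {m : ℕ} (e : Y) (c : Simplex m Y →₀ ℝ) :
    coneChain C (g e) (c.mapDomain g.comp) = (coneChain C e c).mapDomain g.comp := by
  rw [Finsupp.lmapDomain_apply, Finsupp.lmapDomain_apply, ← Finsupp.mapDomain_comp,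
    ← Finsupp.mapDomain_comp]
  congr 1
  funext τ
  exact hg.commutes.cone e τ

lemma IsSymmetry.smearHomotopy (hg : IsSymmetry C K g) {m : ℕ} (x : LabelledSimplex m V Y) :
    smearHomotopy C K m (x.map g) = (smearHomotopy C K m x).mapDomain g.comp := by
  induction m with
  | zero =>
    rw [smearHomotopy_zero, smearHomotopy_zero, hg.smearSub, ← coneChain_mapDomain hg]
    rfl
  | succ m ih =>
    rw [smearHomotopy_succ, smearHomotopy_succ, hg.smearSub, ← coneChain_mapDomain hg]
    refine congrArg (coneChain C (g (x.2 (stdSimplex.vertex 0)))) ?_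
    rw [← Finsupp.lmapDomain_apply ℝ ℝ g.comp (_ - _), map_sub]
    congr 1
    rw [boundary_single, boundary_single, map_sum, map_sum, map_sum]
    refine Finset.sum_congr rfl fun i _ => ?_
    rw [map_smul, map_smul, map_smul, Finsupp.linearCombination_single,
      Finsupp.linearCombination_single, one_smul, one_smul, Finsupp.lmapDomain_apply, ← ih]
    rfl

variable {Z : Type*} [TopologicalSpace Z]

/-- The image of a singular chain under a continuous map. -/
abbrev pushForward (p : C(Y, Z)) (m : ℕ) : (Simplex m Y →₀ ℝ) →ₗ[ℝ] (Simplex m Z →₀ ℝ) :=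
  Finsupp.lmapDomain ℝ ℝ p.comp

lemma boundary_pushForward (p : C(Y, Z)) {m : ℕ} (c : Simplex (m + 1) Y →₀ ℝ) :
    singularBoundary m Z (pushForward p (m + 1) c) = pushForward p m (singularBoundary m Y c) :=
  boundary_mapDomain face face p.comp p.comp (fun _ _ => rfl) c

/-- Descent of the chain homotopy. Let simplices of the base be lifted to labelled simplices of the
total space, compatibly with faces up to symmetries over the base. Then on cycles of the base
smeared straightening changes the projected lift by a boundary. -/
lemma exists_boundary_eq (hK : ∀ v e, ((K v e).sum fun _ r => r) = 1) (p : C(Y, Z)) {A B : Type*}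
    {m : ℕ} (d : Fin (m + 2) → A → B) (X : A → LabelledSimplex (m + 1) V Y)
    (X' : B → LabelledSimplex m V Y)
    (hX : ∀ i a, ∃ g : C(Y, Y), IsSymmetry C K g ∧ p.comp g = p ∧
      labelledFace i (X a) = (X' (d i a)).map g)
    {c : A →₀ ℝ} (hc : boundary d c = 0) :
    ∃ b : Simplex (m + 2) Z →₀ ℝ, singularBoundary (m + 1) Z b =
      pushForward p (m + 1) (Finsupp.linearCombination ℝ (fun a => smearSub C K (m + 1) (X a)) c) := by
  refine ⟨pushForward p _ (Finsupp.linearCombination ℝ (fun a => smearHomotopy C K _ (X a)) c), ?_⟩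
  have h1 : singularBoundary (m + 1) Z ∘ₗ pushForward p _ ∘ₗ
      Finsupp.linearCombination ℝ (fun a => smearHomotopy C K (m + 1) (X a)) =
      pushForward p (m + 1) ∘ₗ Finsupp.linearCombination ℝ (fun a => smearSub C K (m + 1) (X a)) -
        pushForward p (m + 1) ∘ₗ Finsupp.linearCombination ℝ (fun b => smearHomotopy C K m (X' b)) ∘ₗ
          boundary d := by
    refine Finsupp.lhom_ext' fun a => LinearMap.ext_ring ?_
    simp only [LinearMap.comp_apply, LinearMap.sub_apply, Finsupp.lsingle_apply,
      Finsupp.linearCombination_single, one_smul]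
    rw [boundary_pushForward, boundary_smearHomotopy_succ C hK, map_sub]
    congr 1
    rw [boundary_single, boundary_single, map_sum, map_sum, map_sum, map_sum]
    refine Finset.sum_congr rfl fun i _ => ?_
    obtain ⟨g, hg, hpg, h⟩ := hX i a
    rw [map_smul, map_smul, map_smul, map_smul, Finsupp.linearCombination_single,
      Finsupp.linearCombination_single, one_smul, one_smul, h, hg.smearHomotopy,
      Finsupp.lmapDomain_apply, Finsupp.lmapDomain_apply, ← Finsupp.mapDomain_comp]
    congr 2
    funext τ
    rw [Function.comp_apply, ← ContinuousMap.comp_assoc, hpg]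
  refine congr($h1 c).trans ?_
  rw [LinearMap.sub_apply, LinearMap.comp_apply, LinearMap.comp_apply, LinearMap.comp_apply, hc,
    map_zero, map_zero, sub_zero]

/-- In degree zero every chain is a cycle. -/
lemma exists_boundary_eq_zero (hK : ∀ v e, ((K v e).sum fun _ r => r) = 1) (p : C(Y, Z))
    {A : Type*} (X : A → LabelledSimplex 0 V Y) (c : A →₀ ℝ) :
    ∃ b : Simplex 1 Z →₀ ℝ, singularBoundary 0 Z b =
      pushForward p 0 (Finsupp.linearCombination ℝ (fun a => smearSub C K 0 (X a)) c) := by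
  refine ⟨pushForward p _ (Finsupp.linearCombination ℝ (fun a => smearHomotopy C K _ (X a)) c), ?_⟩
  rw [boundary_pushForward, Finsupp.linearCombination_apply, Finsupp.linearCombination_apply,
    map_finsuppSum]
  simp only [map_smul, boundary_smearHomotopy_zero C hK]

end Straightening

/-! ### Almost invariant smearing -/

section Smearing

variable {E Z : Type u} [TopologicalSpace E] [TopologicalSpace Z] {p : E → Z}
  (cov : IsCoveringMap p) {z₀ : Z}

/-- The law of the endpoint of the transport of `e` along the inverse of a `μ`-random loop. Inverses
turn transport into a right action, so that moving `e` corresponds to a left translation of `μ`. -/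
def spread (μ : FundamentalGroup Z z₀ →₀ ℝ) (e : E) : E →₀ ℝ :=
  μ.mapDomain fun γ => transport cov z₀ γ⁻¹ e

lemma spread_sum (μ : FundamentalGroup Z z₀ →₀ ℝ) (e : E) :
    ((spread cov μ e).sum fun _ r => r) = μ.sum fun _ r => r :=
  Finsupp.sum_mapDomain_index (fun _ => rfl) fun _ _ _ => rfl

lemma l1_spread_le (μ : FundamentalGroup Z z₀ →₀ ℝ) (e : E) : l1 (spread cov μ e) ≤ l1 μ :=
  l1_mapDomain_le _ _

lemma spread_deck {g : C(E, E)} (hg : ∀ x, p (g x) = p x) (μ : FundamentalGroup Z z₀ →₀ ℝ) (e : E) :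
    spread cov μ (g e) = (spread cov μ e).mapDomain g := by
  rw [spread, spread, ← Finsupp.mapDomain_comp]
  congr 1
  funext γ
  exact transport_deck cov hg γ⁻¹ e

/-- Moving `e` by `γ` changes the spread measure by at most as much as translating `μ` does. -/
lemma l1_spread_transport_sub_le (μ : FundamentalGroup Z z₀ →₀ ℝ) (γ : FundamentalGroup Z z₀)
    (e : E) :
    l1 (spread cov μ (transport cov z₀ γ e) - spread cov μ e) ≤ l1 (μ.mapDomain (γ⁻¹ * ·) - μ) := by
  have h : spread cov μ (transport cov z₀ γ e) = spread cov (μ.mapDomain (γ⁻¹ * ·)) e := by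
    rw [spread, spread, ← Finsupp.mapDomain_comp]
    congr 1
    funext δ
    simp only [Function.comp_apply, mul_inv_rev, inv_inv, transport_mul]
  rw [h]
  simp only [spread, ← Finsupp.lmapDomain_apply ℝ ℝ]
  rw [← map_sub]
  exact l1_mapDomain_le _ _

end Smearing

/-- An amenable subgroup `Γ` of a group `G` carries almost invariant probability measures, regarded
as measures on `G`. -/
lemma exists_almost_invariant_of_subgroup {G : Type u} [Group G] {Γ : Subgroup G}
    (hΓ : IsAmenable Γ) {κ : Type*} [Fintype κ] (k : κ → G) {ε : ℝ} (hε : 0 < ε) :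
    ∃ μ : G →₀ ℝ, l1 μ ≤ 1 ∧ (μ.sum fun _ r => r) = 1 ∧
      ∀ j, k j ∈ Γ → l1 (μ.mapDomain ((k j)⁻¹ * ·) - μ) < ε := by
  classical
  obtain ⟨μ, h0, h1, h⟩ := hΓ.exists_almost_invariant
    (fun j => if hj : k j ∈ Γ then (⟨k j, hj⟩ : Γ)⁻¹ else 1) hε
  have hsum : ((μ.mapDomain Subtype.val).sum fun (_ : G) r => r) = 1 :=
    (Finsupp.sum_mapDomain_index (fun _ => rfl) fun _ _ _ => rfl).trans h1
  have hl1 : l1 μ = 1 := by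
    rw [← h1]
    exact Finset.sum_congr rfl fun x _ => abs_of_nonneg (h0 x)
  refine ⟨μ.mapDomain Subtype.val, (l1_mapDomain_le _ _).trans hl1.le, hsum, fun j hj => ?_⟩
  have := h j
  rw [dif_pos hj] at this
  refine lt_of_le_of_lt ?_ this
  refine le_trans (le_of_eq ?_) (l1_mapDomain_le (Subtype.val : Γ → G) _)
  congr 1
  rw [← Finsupp.lmapDomain_apply ℝ ℝ _ (_ - _), map_sub, Finsupp.lmapDomain_apply,
    Finsupp.lmapDomain_apply, ← Finsupp.mapDomain_comp, ← Finsupp.mapDomain_comp]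
  rfl

/-! ### Simplices of a simplicial set, as singular simplices -/

section Singular

variable {S : SSet.{u}} {X : TopCat.{u}} (f : SSet.toTop.obj S ⟶ X)

lemma singularSimplex_δ {n : ℕ} (i : Fin (n + 2)) (σ : S _⦋n + 1⦌) :
    singularSimplex f (S.δ i σ) = face i (singularSimplex f σ) := by
  have h := congr($((sSetTopAdj.homEquiv S X f).naturality (SimplexCategory.δ i).op) σ)
  exact congrArg (TopCat.toSSetObjEquiv X _) h

lemma vertex_δ {n : ℕ} (i : Fin (n + 2)) (σ : S _⦋n + 1⦌) (k : Fin (n + 1)) :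
    vertex (S.δ i σ) k = vertex σ (i.succAbove k) := by
  have h : SimplexCategory.const ⦋0⦌ ⦋n⦌ k ≫ SimplexCategory.δ i =
      SimplexCategory.const ⦋0⦌ ⦋n + 1⦌ (i.succAbove k) := by
    rw [SimplexCategory.const_comp]
    rfl
  rw [vertex, vertex, ← h, op_comp]
  exact (S.map_comp_apply _ _ σ).symm

/-- The singular simplex of `X`, as a simplex of the singular simplicial set. -/
def ofSimplex (X : TopCat.{u}) {n : ℕ} (τ : Simplex n X) : (TopCat.toSSet.obj X) _⦋n⦌ :=
  (TopCat.toSSetObjEquiv X _).symm τ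

lemma δ_ofSimplex (X : TopCat.{u}) {n : ℕ} (i : Fin (n + 2)) (τ : Simplex (n + 1) X) :
    (TopCat.toSSet.obj X).δ i (ofSimplex X τ) = ofSimplex X (face i τ) := rfl

lemma simplicialBoundary_ofSimplex (X : TopCat.{u}) {n : ℕ} (b : Simplex (n + 1) X →₀ ℝ) :
    simplicialBoundary (TopCat.toSSet.obj X) n (b.mapDomain (ofSimplex X)) =
      (singularBoundary n X b).mapDomain (ofSimplex X) :=
  boundary_mapDomain face (fun i σ => (TopCat.toSSet.obj X).δ i σ) (ofSimplex X) (ofSimplex X)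
    (fun i τ => δ_ofSimplex X i τ) b

lemma mapDomain_pushChain {Z : TopCat.{u}} (α : X ⟶ Z) {n : ℕ} (c : S _⦋n⦌ →₀ ℝ) :
    (pushChain f c).mapDomain ((TopCat.toSSet.map α).app _) =
      (c.mapDomain fun σ => α.hom.comp (singularSimplex f σ)).mapDomain (ofSimplex Z) := by
  rw [pushChain, ← Finsupp.mapDomain_comp, ← Finsupp.mapDomain_comp]
  rfl

end Singular

/-! ### The amenable reduction estimate -/

section Reduction

variable {S : SSet.{u}} {X Z : TopCat.{u}} (f : SSet.toTop.obj S ⟶ X) (α : X ⟶ Z)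
  {E : Type u} [TopologicalSpace E] {p : E → Z}

instance contractibleSpace_stdSimplex (m : ℕ) :
    ContractibleSpace (stdSimplex ℝ (Fin (m + 1))) :=
  (convex_stdSimplex ℝ (Fin (m + 1))).contractibleSpace ⟨_, single_mem_stdSimplex ℝ 0⟩

lemma exists_simplex_lift (cov : IsCoveringMap p) (hp : Function.Surjective p) {m : ℕ} (σ : S _⦋m⦌) :
    ∃ τ : Simplex m E, ∀ x, p (τ x) = α (singularSimplex f σ x) := by
  obtain ⟨e, he⟩ := hp (α (singularSimplex f σ (stdSimplex.vertex 0)))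
  obtain ⟨τ, hτ, -⟩ := exists_lift_of_contractible cov (α.hom.comp (singularSimplex f σ))
    (stdSimplex.vertex 0) e he
  exact ⟨τ, hτ⟩

/-- Two lifts of a singular simplex differ by a deck transformation. -/
lemma exists_deck_comp_eq [ContractibleSpace E] (cov : IsCoveringMap p) {m : ℕ}
    (τ τ' : Simplex m E) (h : ∀ x, p (τ x) = p (τ' x)) :
    ∃ g : C(E, E), (∀ x, p (g x) = p x) ∧ τ' = g.comp τ := by
  obtain ⟨g, hg, hg'⟩ := exists_lift_of_contractible cov ⟨p, cov.continuous⟩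
    (τ (stdSimplex.vertex 0)) (τ' (stdSimplex.vertex 0)) (h _).symm
  exact ⟨g, hg, DFunLike.coe_injective <| cov.eq_of_comp_eq τ'.continuous (g.comp τ).continuous
    (funext fun x => (h x).symm.trans (hg _).symm) (stdSimplex.vertex 0) hg'.symm⟩

variable {C : Contraction E} {K : S _⦋0⦌ → E → E →₀ ℝ}

/-- The `α`-image of the class of `f_* c` is represented by the smeared straightening of `c`. -/
lemma simplicialNorm_le_smear [ContractibleSpace E] (cov : IsCoveringMap p)
    (hp : Function.Surjective p)
    (hK : ∀ v e, ((K v e).sum fun _ r => r) = 1)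
    (hsym : ∀ g : C(E, E), (∀ x, p (g x) = p x) → IsSymmetry C K g)
    {n : ℕ} (T : S _⦋n⦌ → Simplex n E) (hT : ∀ σ x, p (T σ x) = α (singularSimplex f σ x))
    {c : S _⦋n⦌ →₀ ℝ} (hc : IsCycle S c) {h : singularHomology n X}
    (hh : Represents (TopCat.toSSet.obj X) (pushChain f c) h) :
    simplicialNorm ((singularHomologyMap n α).hom h) ≤
      ∑ σ ∈ c.support, |c σ| * l1 (smear C K n (vertex σ, T σ)) := by
  let p' : C(E, Z) := ⟨p, cov.continuous⟩
  obtain ⟨b, hb⟩ : ∃ b : Simplex (n + 1) Z →₀ ℝ, singularBoundary n Z b =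
      pushForward p' n
        (Finsupp.linearCombination ℝ (fun σ => smearSub C K n (vertex σ, T σ)) c) := by
    rcases n with _ | n
    · exact exists_boundary_eq_zero hK p' (fun σ => (vertex σ, T σ)) c
    · choose T' hT' using fun σ : S _⦋n⦌ => exists_simplex_lift f α cov hp σ
      refine exists_boundary_eq hK p' (fun i σ => S.δ i σ) (fun σ => (vertex σ, T σ))
        (fun σ => (vertex σ, T' σ)) (fun i σ => ?_) (boundary_eq_zero_of_isCycle S hc)
      obtain ⟨g, hg, hg'⟩ := exists_deck_comp_eq cov (T' (S.δ i σ)) (face i (T σ)) fun x => by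
        rw [hT', face_apply, hT, singularSimplex_δ]
        rfl
      refine ⟨g, hsym g hg, ContinuousMap.ext hg, Prod.ext ?_ hg'⟩
      funext k
      exact (vertex_δ i σ k).symm
  have hrep := (hh.map α).add_boundary (b.mapDomain (ofSimplex Z))
  have hchain : (pushChain f c).mapDomain ((TopCat.toSSet.map α).app _) +
      simplicialBoundary (TopCat.toSSet.obj Z) n (b.mapDomain (ofSimplex Z)) =
      (pushForward p' n (Finsupp.linearCombination ℝ
        (fun σ => smear C K n (vertex σ, T σ)) c)).mapDomain (ofSimplex Z) := by
    have h1 : (c.mapDomain fun σ => α.hom.comp (singularSimplex f σ)) =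
        pushForward p' n (Finsupp.linearCombination ℝ (fun σ => Finsupp.single (T σ) 1) c) := by
      rw [Finsupp.linearCombination_apply, map_finsuppSum, Finsupp.mapDomain]
      refine Finsupp.sum_congr fun σ _ => ?_
      rw [map_smul, Finsupp.lmapDomain_apply, Finsupp.mapDomain_single, Finsupp.smul_single,
        smul_eq_mul, mul_one]
      congr 1
      ext x
      exact (hT σ x).symm
    rw [mapDomain_pushChain, simplicialBoundary_ofSimplex, hb, h1, ← Finsupp.mapDomain_add,
      ← map_add]
    congr 2
    simp only [Finsupp.linearCombination_apply]
    rw [← Finsupp.sum_add]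
    refine Finsupp.sum_congr fun σ _ => ?_
    rw [← smul_add, smearSub, add_sub_cancel]
  rw [hchain] at hrep
  exact (simplicialNorm_le hrep).trans <| (l1_mapDomain_le _ _).trans <|
    (l1_mapDomain_le _ _).trans (l1_linearCombination_le _ _)

end Reduction

end AmenableReduction

open AmenableReduction in
theorem mainTheorem3 {X Z : TopCat.{u}}
    (hZ : AmenableReduction.HasContractibleUniversalCover Z) (α : X ⟶ Z)
    (S : SSet.{u}) (f : SSet.toTop.obj S ⟶ X)
    {n : ℕ} (c : S _⦋n⦌ →₀ ℝ) (hc : AmenableReduction.IsCycle S c)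
    {ι : Type v} (V : ι → Set (S _⦋0⦌)) (hV : Pairwise fun k l => Disjoint (V k) (V l))
    (z₀ : Z) (hz₀ : ∀ σ ∈ c.support, ∀ i, α (AmenableReduction.vertexPoint f σ i) = z₀)
    (hΓ : ∀ l, AmenableReduction.IsAmenable (AmenableReduction.edgeSubgroup f α z₀ c (V l)))
    (h : AmenableReduction.singularHomology n X)
    (hh : AmenableReduction.Represents (TopCat.toSSet.obj X)
      (AmenableReduction.pushChain f c) h) :
    AmenableReduction.simplicialNorm ((AmenableReduction.singularHomologyMap n α).hom h)
      ≤ AmenableReduction.essentialNorm f V c := by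
  classical
  obtain ⟨E, _, p, _, cov, hp⟩ := hZ
  obtain ⟨C, hC⟩ := exists_equivariant_contraction cov hp
  choose T hT using fun σ : S _⦋n⦌ => exists_simplex_lift f α cov hp σ
  refine le_of_forall_pos_le_add fun ε hε => ?_
  have hl1 := l1_nonneg c
  -- A bound `δ` for every inessential simplex gives a bound `ε` for all of them together.
  obtain ⟨δ, hδ, hδε⟩ : ∃ δ : ℝ, 0 < δ ∧ l1 c * δ ≤ ε := by
    refine ⟨ε / (l1 c + 1), by positivity, ?_⟩
    rw [mul_div_assoc', div_le_iff₀ (by positivity)]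
    nlinarith
  -- The loops given by the edges of the simplices of `c`, and the lifts of these edges.
  let edge (q : c.support × Fin (n + 1) × Fin (n + 1)) : Path z₀ z₀ :=
    ((edgePath f q.1.1 q.2.1 q.2.2).map α.hom.continuous).cast
      (hz₀ q.1.1 q.1.2 q.2.1).symm (hz₀ q.1.1 q.1.2 q.2.2).symm
  let edgeClass (q : c.support × Fin (n + 1) × Fin (n + 1)) : FundamentalGroup Z z₀ :=
    FundamentalGroup.fromPath (Path.Homotopic.Quotient.mk (edge q))
  have hlift (σ : S _⦋n⦌) (i j : Fin (n + 1)) (t : unitInterval) :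
      p ((stdEdge i j).map (T σ).continuous t) =
        (edgePath f σ i j).map α.hom.continuous t := hT σ _
  choose μ hμ1 hμs hμ using fun l => exists_almost_invariant_of_subgroup (hΓ l) edgeClass hδ
  -- The measure attached to a vertex depends on its color only; uncolored vertices do not move.
  let ν (v : S _⦋0⦌) : FundamentalGroup Z z₀ →₀ ℝ :=
    if hv : ∃ l, v ∈ V l then μ hv.choose else Finsupp.single 1 1
  have hν {v : S _⦋0⦌} {l : ι} (hv : v ∈ V l) : ν v = μ l := by
    have hv' : ∃ l, v ∈ V l := ⟨l, hv⟩
    have : hv'.choose = l := by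
      by_contra hne
      exact Set.disjoint_left.1 (hV hne) hv'.choose_spec hv
    simp only [ν, dif_pos hv', this]
  have hν1 (v : S _⦋0⦌) : l1 (ν v) ≤ 1 := by
    by_cases hv : ∃ l, v ∈ V l
    · simp only [ν, dif_pos hv, hμ1]
    · simp [ν, dif_neg hv]
  have hνs (v : S _⦋0⦌) : ((ν v).sum fun _ r => r) = 1 := by
    by_cases hv : ∃ l, v ∈ V l
    · simp only [ν, dif_pos hv, hμs]
    · simp [ν, dif_neg hv]
  let K (v : S _⦋0⦌) (e : E) : E →₀ ℝ := spread cov (ν v) e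
  have hK1 (v : S _⦋0⦌) (e : E) : l1 (K v e) ≤ 1 := (l1_spread_le cov _ _).trans (hν1 v)
  have hsym (g : C(E, E)) (hg : ∀ x, p (g x) = p x) : IsSymmetry C K g :=
    ⟨hC g hg, fun v e => spread_deck cov hg (ν v) e⟩
  refine (simplicialNorm_le_smear f α cov hp (fun v e => (spread_sum cov _ _).trans (hνs v))
    hsym T hT hc hh).trans ?_
  have hiness (σ : S _⦋n⦌) (hσ : σ ∈ c.support) (hess : ¬ IsEssential f V σ) :
      l1 (smear C K n (vertex σ, T σ)) ≤ δ := by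
    rw [IsEssential, not_and_or, not_not, not_not] at hess
    -- Either the laws of two vertices of the same color almost agree, or the lifts of two vertices
    -- with the same label agree.
    rcases hess with ⟨l, i, j, hij, hi, hj⟩ | ⟨i, j, hij, hv, hnull⟩
    · refine (l1_smear_le C hK1 _ (i := i) (j := j) fun h => hij (by rw [h])).trans ?_
      have h1 : transport cov z₀ (edgeClass (⟨σ, hσ⟩, i, j)) (T σ (stdSimplex.vertex i)) =
          T σ (stdSimplex.vertex j) :=
        transport_mk cov ((stdEdge i j).map (T σ).continuous) _ (hlift σ i j)
      have h2 : edgeClass (⟨σ, hσ⟩, i, j) ∈ edgeSubgroup f α z₀ c (V l) :=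
        Subgroup.subset_closure ⟨σ, hσ, i, j, hi, hj, _, _, rfl⟩
      change l1 (spread cov (ν (vertex σ j)) (T σ (stdSimplex.vertex j)) -
        spread cov (ν (vertex σ i)) (T σ (stdSimplex.vertex i))) ≤ δ
      rw [hν hi, hν hj, ← h1]
      exact (l1_spread_transport_sub_le cov _ _ _).trans (hμ l _ h2).le
    · refine (l1_smear_le C hK1 _ hij).trans ?_
      have h1 : T σ (stdSimplex.vertex i) = T σ (stdSimplex.vertex j) :=
        eq_of_isNullHomotopicLoop cov ((stdEdge i j).map (T σ).continuous) _ (hlift σ i j)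
          (hnull.map α.hom)
      simp only [vertexMeasures, h1, hv, sub_self, l1_zero]
      exact hδ.le
  calc ∑ σ ∈ c.support, |c σ| * l1 (smear C K n (vertex σ, T σ))
      ≤ ∑ σ ∈ c.support, ((if IsEssential f V σ then |c σ| else 0) + |c σ| * δ) := by
        refine Finset.sum_le_sum fun σ hσ => ?_
        have h0 := abs_nonneg (c σ)
        split_ifs with hess
        · have := mul_le_of_le_one_right h0 (l1_smear_le_one C hK1 (m := n) (vertex σ, T σ))
          have := mul_nonneg h0 hδ.le
          linarith
        · have := mul_le_mul_of_nonneg_left (hiness σ hσ hess) h0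
          linarith
    _ = essentialNorm f V c + l1 c * δ := by
        rw [Finset.sum_add_distrib, ← Finset.sum_filter, ← Finset.sum_mul, essentialNorm, l1,
          Finsupp.sum]
    _ ≤ essentialNorm f V c + ε := by gcongr

end
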